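/- For a partition $\lambda$ of $n$ let $d_\lambda$ be the dimension of the irreducible complex representation of the symmetric group $S_n$ attached to $\lambda$ (the Specht module $S^\lambda$), let $p(n)$ be the number of partitions of $n$, and let $m_n$ be the maximal dimension of an irreducible complex representation of $S_n$. Put $a_0=\frac{\pi\sqrt2}{\sqrt3}-2$. Then there is an $N$ such that for every $n\ge N$ and every real number $A_n$ with $0<A_n<1$ the following holds: if $C_n$ is the real number defined by $$C_n\,p(n)=\bigl|\{\lambda\vdash n \mid m_nA_n\le d_\lambda\le m_n\}\bigr|,$$ then $$(A_nC_n)^2\le e^{-a_0\sqrt n}.$$ -/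

import Mathlib

noncomputable section

namespace SymDim

/-- The Young diagram of a partition `μ` of `n`: its row lengths are the parts of `μ` in weakly
decreasing order. -/
def diagram {n : ℕ} (μ : n.Partition) : YoungDiagram :=
  YoungDiagram.ofRowLens (μ.parts.sort (· ≥ ·)) (μ.parts.pairwise_sort (· ≥ ·)).sortedGE

/-- A Young tableau of shape `μ`: a bijective filling of the boxes of the diagram with the elements
of `Fin n`. It is given by the map sending an entry to its box, a pair `(row, column)`. -/
abbrev Tableau {n : ℕ} (μ : n.Partition) : Type :=
  Fin n ≃ ↥(diagram μ).cells

theorem card_cellsOfRowLens (w : List ℕ) : (YoungDiagram.cellsOfRowLens w).card = w.sum := by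
  induction w with
  | nil => simp [YoungDiagram.cellsOfRowLens]
  | cons a w ih =>
    rw [YoungDiagram.cellsOfRowLens, Finset.card_union_of_disjoint]
    · simp [ih]
    · rw [Finset.disjoint_left]
      rintro ⟨i, j⟩ h h'
      simp at h h'
      omega

/-- The diagram of a partition of `n` has `n` boxes. -/
theorem card_diagram {n : ℕ} (μ : n.Partition) : (diagram μ).cells.card = n := by
  have h := card_cellsOfRowLens (μ.parts.sort (· ≥ ·))
  rw [← Multiset.sum_coe, Multiset.sort_eq, μ.parts_sum] at h
  exact h

/-- Every partition has a tableau. -/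
theorem nonempty_tableau {n : ℕ} (μ : n.Partition) : Nonempty (Tableau μ) :=
  ⟨Fintype.equivOfCardEq (by simp [card_diagram])⟩

/-- The permutation representation of `S_n` on the free complex vector space over the functions
`t : Fin n → ℕ`, where `σ` sends the basis vector of `t` to the basis vector of `t ∘ σ⁻¹`. The
tabloid of a tableau (its class modulo permutations within rows) is encoded by the function that
sends each entry to its row, so every permutation module on tabloids is a subrepresentation. -/
def tabloidRep (n : ℕ) : Representation ℂ (Equiv.Perm (Fin n)) ((Fin n → ℕ) →₀ ℂ) where
  toFun σ := Finsupp.lmapDomain ℂ ℂ (fun t => t ∘ ⇑σ⁻¹)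
  map_one' := by
    ext t
    simp
  map_mul' σ τ := by
    ext t
    simp [Function.comp_assoc, Equiv.Perm.coe_mul, mul_inv_rev]

/-- The column group of a tableau: the permutations of the entries that keep every entry in its
column. -/
def columnGroup {n : ℕ} {μ : n.Partition} (T : Tableau μ) : Finset (Equiv.Perm (Fin n)) :=
  Finset.univ.filter fun σ => ∀ k, (T (σ k)).1.2 = (T k).1.2

/-- The polytabloid `e_T = ∑_σ sgn(σ) σ{T}`, summed over the column group of `T`; here `{T}` is the
tabloid of `T`. -/
def polytabloid {n : ℕ} {μ : n.Partition} (T : Tableau μ) : (Fin n → ℕ) →₀ ℂ :=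
  ∑ σ ∈ columnGroup T,
    ((Equiv.Perm.sign σ : ℤ) : ℂ) •
      tabloidRep n σ (Finsupp.single (fun k => (T k).1.1) 1)

theorem tabloidRep_polytabloid {n : ℕ} {μ : n.Partition} (T : Tableau μ)
    (τ : Equiv.Perm (Fin n)) :
    tabloidRep n τ (polytabloid T) = polytabloid (μ := μ) (τ⁻¹.trans T) := by
  unfold polytabloid
  rw [map_sum]
  refine Finset.sum_bij (fun σ _ => τ * σ * τ⁻¹) ?_ ?_ ?_ ?_
  · intro σ hσ
    simp only [columnGroup, Finset.mem_filter, Finset.mem_univ, true_and] at hσ ⊢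
    intro k
    simpa using hσ (τ⁻¹ k)
  · intro σ _ σ' _ h
    simpa using h
  · intro ρ hρ
    refine ⟨τ⁻¹ * ρ * τ, ?_, by group⟩
    simp only [columnGroup, Finset.mem_filter, Finset.mem_univ, true_and] at hρ ⊢
    intro k
    simpa using hρ (τ k)
  · intro σ _
    have h1 : Finsupp.single (fun k => ((τ⁻¹.trans T : Tableau μ) k).1.1) (1 : ℂ)
        = tabloidRep n τ (Finsupp.single (fun k => (T k).1.1) 1) := by
      simp [tabloidRep, Finsupp.mapDomain_single, Function.comp_def]
    rw [h1, map_smul, ← Module.End.mul_apply, ← Module.End.mul_apply, ← map_mul, ← map_mul]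
    have h2 : Equiv.Perm.sign (τ * σ * τ⁻¹) = Equiv.Perm.sign σ := by
      rw [map_mul, map_mul, map_inv, mul_comm (Equiv.Perm.sign τ), mul_inv_cancel_right]
    rw [h2, inv_mul_cancel_right]

/-- The Specht module `S^μ`: the span of all polytabloids of shape `μ`. It is the irreducible
complex representation of `S_n` attached to the partition `μ`. -/
def specht {n : ℕ} (μ : n.Partition) : Subrepresentation (tabloidRep n) where
  toSubmodule := Submodule.span ℂ (Set.range fun T : Tableau μ => polytabloid T)
  apply_mem_toSubmodule τ v hv := by
    induction hv using Submodule.span_induction with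
    | mem x hx =>
      obtain ⟨T, rfl⟩ := hx
      exact Submodule.subset_span ⟨τ⁻¹.trans T, (tabloidRep_polytabloid T τ).symm⟩
    | zero => simp
    | add x y _ _ hx hy => rw [map_add]; exact Submodule.add_mem _ hx hy
    | smul a x _ hx => rw [map_smul]; exact Submodule.smul_mem _ a hx

/-- `d_μ`, the dimension of the irreducible representation of `S_n` attached to `μ`. -/
def dim {n : ℕ} (μ : n.Partition) : ℕ :=
  Module.finrank ℂ (specht μ).toSubmodule

/-- The set of dimensions of the irreducible finite-dimensional complex representations of `S_n`. -/
def irrepDims (n : ℕ) : Set ℕ :=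
  {d | ∃ ρ : Representation ℂ (Equiv.Perm (Fin n)) (Fin d → ℂ), ρ.IsIrreducible}

/-- `m_n`, the maximal dimension of an irreducible representation of `S_n`. -/
def maxDim (n : ℕ) : ℕ := sSup (irrepDims n)

/-- The supremum that defines `m_n` is a maximum. -/
theorem isGreatest_maxDim (n : ℕ) : IsGreatest (irrepDims n) (maxDim n) := by
  have hne : (irrepDims n).Nonempty := by
    refine ⟨1, 1, ?_⟩
    have hs : IsSimpleOrder (Submodule ℂ (Fin 1 → ℂ)) :=
      isSimpleModule_iff_finrank_eq_one.mpr (by simp) |>.toIsSimpleOrder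
    refine { exists_pair_ne := ⟨⊥, ⊤, fun h => ?_⟩, eq_bot_or_eq_top := fun W => ?_ }
    · exact bot_ne_top (α := Submodule ℂ (Fin 1 → ℂ)) (congrArg Subrepresentation.toSubmodule h)
    · rcases hs.eq_bot_or_eq_top W.toSubmodule with h | h
      · exact Or.inl (Subrepresentation.toSubmodule_injective h)
      · exact Or.inr (Subrepresentation.toSubmodule_injective h)
  have hbdd : BddAbove (irrepDims n) := by
    refine ⟨Fintype.card (Equiv.Perm (Fin n)), ?_⟩
    rintro d ⟨ρ, hρ⟩
    rcases Nat.eq_zero_or_pos d with rfl | hd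
    · exact Nat.zero_le _
    have v0 : (fun _ => 1 : Fin d → ℂ) ≠ 0 := fun h => one_ne_zero (congrFun h ⟨0, hd⟩)
    let W : Subrepresentation ρ :=
      { toSubmodule := Submodule.span ℂ (Set.range fun g => ρ g (fun _ => 1))
        apply_mem_toSubmodule := fun τ v hv => by
          induction hv using Submodule.span_induction with
          | mem x hx =>
            obtain ⟨g, rfl⟩ := hx
            exact Submodule.subset_span ⟨τ * g, by simp⟩
          | zero => simp
          | add x y _ _ hx hy => rw [map_add]; exact Submodule.add_mem _ hx hy
          | smul a x _ hx => rw [map_smul]; exact Submodule.smul_mem _ a hx }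
    have hW : W.toSubmodule = ⊤ := by
      rcases hρ.eq_bot_or_eq_top W with h | h
      · refine absurd ?_ v0
        have hm : (fun _ => 1 : Fin d → ℂ) ∈ W.toSubmodule :=
          Submodule.subset_span ⟨1, by simp⟩
        rw [h] at hm
        exact (Submodule.mem_bot ℂ).mp hm
      · rw [h]; rfl
    have h1 : Module.finrank ℂ W.toSubmodule ≤ Fintype.card (Equiv.Perm (Fin n)) :=
      finrank_range_le_card (R := ℂ) (fun g : Equiv.Perm (Fin n) => ρ g (fun _ => 1))
    rw [hW] at h1
    simpa using h1
  exact ⟨Nat.sSup_mem hne hbdd, fun d hd => le_csSup hbdd hd⟩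

/-- The set of partitions `μ` of `n` with `m_n A ≤ d_μ ≤ m_n`. -/
def largeDim (n : ℕ) (A : ℝ) : Set n.Partition :=
  {μ | (maxDim n : ℝ) * A ≤ (dim μ : ℝ) ∧ dim μ ≤ maxDim n}

end SymDim

end

/-! ### Row sums of fillings that are injective on columns. -/

noncomputable section

namespace SymDim

/-! Let `I` be the number of permutations in `S_n` with square one. Two identities carry the proof:
`∑ d_λ² = n!` and `∑ d_λ = I`. The first gives `n! ≤ m_n I`; the second, restricted to the
partitions counted by `C`, gives `m_n A C p(n) ≤ I`. Hence `A C p(n) ≤ I² / n!`, which is at most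
`exp (2√n)` by the recursion for involutions. With `c = π√2/√3`, squaring gives the claim once `p(n)
≥ exp ((1 + c/2)√n)`. As `1 + c/2 < c`, the sharp asymptotics of `p(n)` are not needed: an
elementary induction on `n p(n) = ∑ v p(n - kv)`, truncated, suffices. The identities need the
Specht modules to be irreducible and pairwise non-isomorphic (James's argument with signed column
sums), a count of conjugacy classes, and an invariant nondegenerate symmetric form, which makes
every Frobenius-Schur indicator `1`. -/

theorem sum_range_card_le_sum_id (s : Finset ℕ) :
    ∑ i ∈ Finset.range s.card, i ≤ ∑ i ∈ s, i := by
  induction hc : s.card generalizing s with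
  | zero => simp
  | succ m ih =>
    have hne : s.Nonempty := Finset.card_pos.mp (by omega)
    set a := s.max' hne
    have ha : a ∈ s := s.max'_mem hne
    have hsub : s ⊆ Finset.range (a + 1) := fun x hx =>
      Finset.mem_range.mpr (Nat.lt_succ_of_le (s.le_max' x hx))
    have h1 := Finset.card_le_card hsub
    have h2 := ih (s.erase a) (by rw [Finset.card_erase_of_mem ha, hc]; rfl)
    rw [Finset.sum_range_succ, ← Finset.sum_erase_add _ _ ha]
    simp only [Finset.card_range] at h1
    omega

/-- Exchange: an element outside the initial segment could be traded for a missing smaller one,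
pushing the sum below the minimum. -/
theorem eq_range_card_of_sum_id_le (s : Finset ℕ)
    (h : ∑ i ∈ s, i ≤ ∑ i ∈ Finset.range s.card, i) : s = Finset.range s.card := by
  refine Finset.eq_of_subset_of_card_le (fun a ha => ?_) (by simp)
  by_contra hlt
  have hns : ¬ Finset.range s.card ⊆ s := fun hsub =>
    hlt (by rw [Finset.eq_of_subset_of_card_le hsub (by simp)]; exact ha)
  obtain ⟨b, hb, hbs⟩ := Finset.not_subset.mp hns
  have hcard : (insert b (s.erase a)).card = s.card := by
    rw [Finset.card_insert_of_notMem (fun h => hbs (Finset.mem_of_mem_erase h)),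
      Finset.card_erase_of_mem ha]
    have := Finset.card_pos.mpr ⟨a, ha⟩
    omega
  have h1 := sum_range_card_le_sum_id (insert b (s.erase a))
  rw [hcard, Finset.sum_insert (fun h => hbs (Finset.mem_of_mem_erase h))] at h1
  have h2 := Finset.sum_erase_add s (fun i => i) ha
  simp only [Finset.mem_range] at hlt hb
  omega

variable {n : ℕ}

/-- The row of an entry of a tableau. -/
def rowFn {μ : n.Partition} (T : Tableau μ) (k : Fin n) : ℕ := (T k).1.1

/-- The column of an entry of a tableau. -/
def colFn {μ : n.Partition} (T : Tableau μ) (k : Fin n) : ℕ := (T k).1.2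

/-- The sum of the row indices of the boxes of the diagram of a partition. -/
def rowSum (μ : n.Partition) : ℕ := ∑ c ∈ (diagram μ).cells, c.1

theorem sum_rowFn {μ : n.Partition} (T : Tableau μ) : ∑ k, rowFn T k = rowSum μ := by
  unfold rowSum rowFn
  rw [← Finset.sum_coe_sort (diagram μ).cells (fun c => c.1)]
  exact Equiv.sum_comp T (fun c => c.1.1)

theorem mem_columnGroup {μ : n.Partition} {T : Tableau μ} {σ : Equiv.Perm (Fin n)} :
    σ ∈ columnGroup T ↔ ∀ k, colFn T (σ k) = colFn T k := by
  simp [columnGroup, colFn]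

theorem one_mem_columnGroup {μ : n.Partition} (T : Tableau μ) : 1 ∈ columnGroup T := by
  simp [mem_columnGroup]

theorem mul_mem_columnGroup {μ : n.Partition} {T : Tableau μ} {σ τ : Equiv.Perm (Fin n)}
    (hσ : σ ∈ columnGroup T) (hτ : τ ∈ columnGroup T) : σ * τ ∈ columnGroup T := by
  rw [mem_columnGroup] at *
  intro k
  rw [Equiv.Perm.mul_apply, hσ, hτ]

theorem inv_mem_columnGroup {μ : n.Partition} {T : Tableau μ} {σ : Equiv.Perm (Fin n)}
    (hσ : σ ∈ columnGroup T) : σ⁻¹ ∈ columnGroup T := by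
  rw [mem_columnGroup] at *
  intro k
  rw [← hσ (σ⁻¹ k)]
  simp

theorem ext_rowFn_colFn {μ : n.Partition} (T : Tableau μ) {k l : Fin n}
    (hr : rowFn T k = rowFn T l) (hc : colFn T k = colFn T l) : k = l :=
  T.injective (Subtype.ext (Prod.ext hr hc))

theorem rowFn_lt_colLen {μ : n.Partition} (T : Tableau μ) (k : Fin n) :
    rowFn T k < (diagram μ).colLen (colFn T k) := by
  rw [← YoungDiagram.mem_iff_lt_colLen]
  exact (T k).2

theorem image_rowFn_column {μ : n.Partition} (T : Tableau μ) (j : ℕ) :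
    (Finset.univ.filter fun k => colFn T k = j).image (rowFn T)
      = Finset.range ((diagram μ).colLen j) := by
  ext i
  simp only [Finset.mem_image, Finset.mem_filter, Finset.mem_univ, true_and, Finset.mem_range]
  constructor
  · rintro ⟨k, rfl, rfl⟩
    exact rowFn_lt_colLen T k
  · intro h
    rw [← YoungDiagram.mem_iff_lt_colLen] at h
    exact ⟨T.symm ⟨(i, j), h⟩, by simp [colFn], by simp [rowFn]⟩

/-- The values of `t` on a column are distinct, so their sum is least when they are `0, 1, …, colLen
- 1`, the row indices themselves. At the minimum every value is again a row of that column. -/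
theorem column_sum_le {μ : n.Partition} (T : Tableau μ) (t : Fin n → ℕ)
    (ht : ∀ k l, colFn T k = colFn T l → t k = t l → k = l) (j : ℕ) :
    (∑ k ∈ Finset.univ.filter (fun k => colFn T k = j), rowFn T k
      ≤ ∑ k ∈ Finset.univ.filter (fun k => colFn T k = j), t k) ∧
    (∑ k ∈ Finset.univ.filter (fun k => colFn T k = j), t k
      ≤ ∑ k ∈ Finset.univ.filter (fun k => colFn T k = j), rowFn T k →
      ∀ k, colFn T k = j → t k < (diagram μ).colLen j) := by
  set K := Finset.univ.filter fun k => colFn T k = j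
  have hK : ∀ k, k ∈ K ↔ colFn T k = j := by simp [K]
  have hinj : Set.InjOn t K := fun k hk l hl h =>
    ht k l (((hK k).mp hk).trans ((hK l).mp hl).symm) h
  have hinj' : Set.InjOn (rowFn T) K := fun k hk l hl h =>
    ext_rowFn_colFn T h (((hK k).mp hk).trans ((hK l).mp hl).symm)
  have h1 : ∑ k ∈ K, t k = ∑ i ∈ K.image t, i := (Finset.sum_image (f := fun i => i) hinj).symm
  have h2 : ∑ k ∈ K, rowFn T k = ∑ i ∈ Finset.range ((diagram μ).colLen j), i := by
    rw [← image_rowFn_column T j]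
    exact (Finset.sum_image (f := fun i => i) hinj').symm
  have hcard : (K.image t).card = (diagram μ).colLen j := by
    rw [Finset.card_image_of_injOn hinj, ← Finset.card_image_of_injOn hinj',
      image_rowFn_column T j, Finset.card_range]
  rw [h1, h2, ← hcard]
  refine ⟨sum_range_card_le_sum_id _, fun h k hk => ?_⟩
  have h3 := eq_range_card_of_sum_id_le _ h
  have h4 : t k ∈ K.image t := Finset.mem_image_of_mem t ((hK k).mpr hk)
  rw [h3] at h4
  exact Finset.mem_range.mp h4

theorem sum_fiberwise_colFn {μ : n.Partition} (T : Tableau μ) (t : Fin n → ℕ) :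
    ∑ k, t k = ∑ j ∈ Finset.univ.image (colFn T),
      ∑ k ∈ Finset.univ.filter (fun k => colFn T k = j), t k :=
  (Finset.sum_fiberwise_of_maps_to (fun _ hk => Finset.mem_image_of_mem _ hk) t).symm

theorem rowSum_le_of_injective_on_columns {μ : n.Partition} (T : Tableau μ) (t : Fin n → ℕ)
    (ht : ∀ k l, colFn T k = colFn T l → t k = t l → k = l) : rowSum μ ≤ ∑ k, t k := by
  rw [← sum_rowFn T, sum_fiberwise_colFn T, sum_fiberwise_colFn T t]
  exact Finset.sum_le_sum fun j _ => (column_sum_le T t ht j).1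

/-- Equality of the totals forces equality in each column. Sending `k` to the entry of `T` in row `t
k` of its own column is then a well-defined column permutation. -/
theorem exists_columnGroup_of_sum_eq {μ : n.Partition} (T : Tableau μ) (t : Fin n → ℕ)
    (ht : ∀ k l, colFn T k = colFn T l → t k = t l → k = l) (hs : ∑ k, t k = rowSum μ) :
    ∃ σ ∈ columnGroup T, t = rowFn T ∘ ⇑σ⁻¹ := by
  have hlt : ∀ k, t k < (diagram μ).colLen (colFn T k) := by
    rw [← sum_rowFn T, sum_fiberwise_colFn T, sum_fiberwise_colFn T (rowFn T)] at hs
    have h := (Finset.sum_eq_sum_iff_of_le fun j _ => (column_sum_le T t ht j).1).mp hs.symm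
    intro k
    exact (column_sum_le T t ht (colFn T k)).2
      (h _ (Finset.mem_image_of_mem _ (Finset.mem_univ k))).ge k rfl
  let f : Fin n → Fin n := fun k =>
    T.symm ⟨(t k, colFn T k), YoungDiagram.mem_iff_lt_colLen.mpr (hlt k)⟩
  have hrow : ∀ k, rowFn T (f k) = t k := fun k => by simp [f, rowFn]
  have hcol : ∀ k, colFn T (f k) = colFn T k := fun k => by simp [f, colFn]
  have hf : Function.Injective f := fun k l h =>
    ht k l (by rw [← hcol k, h, hcol]) (by rw [← hrow k, h, hrow])
  let σ : Equiv.Perm (Fin n) := Equiv.ofBijective f (Finite.injective_iff_bijective.mp hf)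
  refine ⟨σ⁻¹, inv_mem_columnGroup (mem_columnGroup.mpr hcol), ?_⟩
  rw [inv_inv]
  exact funext fun k => (hrow k).symm

theorem card_rowFn_eq {μ : n.Partition} (T : Tableau μ) (i : ℕ) :
    (Finset.univ.filter fun k => rowFn T k = i).card = (diagram μ).rowLen i := by
  rw [YoungDiagram.rowLen_eq_card]
  refine Finset.card_bij (fun k _ => (T k).1) ?_ ?_ ?_
  · intro k hk
    exact YoungDiagram.mem_row_iff.mpr ⟨(T k).2, (Finset.mem_filter.mp hk).2⟩
  · intro k _ l _ h
    exact T.injective (Subtype.ext h)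
  · intro c hc
    obtain ⟨h1, h2⟩ := YoungDiagram.mem_row_iff.mp hc
    exact ⟨T.symm ⟨c, h1⟩, Finset.mem_filter.mpr ⟨Finset.mem_univ _, by simp [rowFn, h2]⟩, by simp⟩

theorem diagram_injective : Function.Injective (diagram (n := n)) := by
  intro μ ν h
  have key : ∀ κ : n.Partition, (diagram κ).rowLens = κ.parts.sort (· ≥ ·) := fun κ =>
    YoungDiagram.rowLens_ofRowLens_eq_self fun x hx => κ.parts_pos (by simpa using hx)
  have h1 : μ.parts.sort (· ≥ ·) = ν.parts.sort (· ≥ ·) := by rw [← key, ← key, h]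
  ext1
  rw [← Multiset.sort_eq (r := (· ≥ ·)) μ.parts, h1, Multiset.sort_eq]

/-- Row lengths are fibre sizes of `rowFn`, which relabelling the entries preserves. -/
theorem eq_of_rowFn_eq_comp {μ ν : n.Partition} (T : Tableau μ) (S : Tableau ν)
    (σ : Equiv.Perm (Fin n)) (h : rowFn S = rowFn T ∘ ⇑σ) : ν = μ := by
  apply diagram_injective
  have hlen : ∀ i, (diagram ν).rowLen i = (diagram μ).rowLen i := by
    intro i
    rw [← card_rowFn_eq S, ← card_rowFn_eq T, h]
    refine Finset.card_bij (fun k _ => σ k) ?_ ?_ ?_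
    · intro k hk
      simpa using hk
    · intro k _ l _ hkl
      exact σ.injective hkl
    · intro k hk
      exact ⟨σ⁻¹ k, by simpa using hk, by simp⟩
  ext ⟨i, j⟩
  rw [YoungDiagram.mem_cells, YoungDiagram.mem_cells, YoungDiagram.mem_iff_lt_rowLen,
    YoungDiagram.mem_iff_lt_rowLen, hlen]

end SymDim
end

/-! ### Specht modules: irreducibility and non-isomorphism. -/

noncomputable section

namespace SymDim

variable {n : ℕ}

/-- The signed sum over the column group of a tableau. -/
def kappa {μ : n.Partition} (T : Tableau μ) : Module.End ℂ ((Fin n → ℕ) →₀ ℂ) :=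
  ∑ σ ∈ columnGroup T, ((Equiv.Perm.sign σ : ℤ) : ℂ) • tabloidRep n σ

theorem kappa_apply {μ : n.Partition} (T : Tableau μ) (v : (Fin n → ℕ) →₀ ℂ) :
    kappa T v = ∑ σ ∈ columnGroup T, ((Equiv.Perm.sign σ : ℤ) : ℂ) • tabloidRep n σ v := by
  simp [kappa, LinearMap.sum_apply]

theorem polytabloid_eq_kappa {μ : n.Partition} (T : Tableau μ) :
    polytabloid T = kappa T (Finsupp.single (rowFn T) 1) := by
  rw [kappa_apply]; rfl

theorem tabloidRep_single (σ : Equiv.Perm (Fin n)) (t : Fin n → ℕ) (a : ℂ) :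
    tabloidRep n σ (Finsupp.single t a) = Finsupp.single (t ∘ ⇑σ⁻¹) a := by
  simp [tabloidRep, Finsupp.mapDomain_single]

theorem sign_mul_self_cast (σ : Equiv.Perm (Fin n)) :
    ((Equiv.Perm.sign σ : ℤ) : ℂ) * ((Equiv.Perm.sign σ : ℤ) : ℂ) = 1 := by
  rw [← Int.cast_mul, ← Units.val_mul, Int.units_mul_self]; simp

theorem kappa_tabloidRep {μ : n.Partition} {T : Tableau μ} {τ : Equiv.Perm (Fin n)}
    (hτ : τ ∈ columnGroup T) (v : (Fin n → ℕ) →₀ ℂ) :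
    kappa T (tabloidRep n τ v) = ((Equiv.Perm.sign τ : ℤ) : ℂ) • kappa T v := by
  rw [kappa_apply, kappa_apply, Finset.smul_sum]
  refine Finset.sum_bij (fun σ _ => σ * τ) (fun σ hσ => mul_mem_columnGroup hσ hτ)
    (fun σ _ σ' _ h => mul_right_cancel h)
    (fun σ hσ => ⟨σ * τ⁻¹, mul_mem_columnGroup hσ (inv_mem_columnGroup hτ), by group⟩) ?_
  intro σ _
  rw [smul_smul, ← Module.End.mul_apply, ← map_mul, Equiv.Perm.sign_mul, Units.val_mul,
    Int.cast_mul, mul_comm ((Equiv.Perm.sign σ : ℤ) : ℂ), ← mul_assoc, sign_mul_self_cast, one_mul]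

/-- The transposition of `k` and `l` lies in the column group and fixes `t`, so the image equals its
own negative. -/
theorem kappa_single_eq_zero {μ : n.Partition} {T : Tableau μ} {t : Fin n → ℕ} {k l : Fin n}
    (hkl : k ≠ l) (hc : colFn T k = colFn T l) (ht : t k = t l) (a : ℂ) :
    kappa T (Finsupp.single t a) = 0 := by
  have hτ : Equiv.swap k l ∈ columnGroup T := by
    rw [mem_columnGroup]
    intro m
    rw [Equiv.swap_apply_def]
    split_ifs with h1 h2
    · rw [h1, hc]
    · rw [h2, hc]
    · rfl
  have h := kappa_tabloidRep hτ (Finsupp.single t a)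
  have h1 : t ∘ ⇑(Equiv.swap k l)⁻¹ = t := by
    funext m
    rw [Equiv.swap_inv, Function.comp_apply, Equiv.swap_apply_def]
    split_ifs with h1 h2
    · rw [h1, ht]
    · rw [h2, ht]
    · rfl
  rw [tabloidRep_single, h1, Equiv.Perm.sign_swap hkl] at h
  simpa [self_eq_neg] using h

theorem kappa_kappa {μ : n.Partition} (T : Tableau μ) (v : (Fin n → ℕ) →₀ ℂ) :
    kappa T (kappa T v) = ((columnGroup T).card : ℂ) • kappa T v := by
  conv_lhs => rw [kappa_apply T v]
  rw [map_sum, Finset.sum_congr rfl fun σ hσ => by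
    rw [map_smul, kappa_tabloidRep hσ, smul_smul, sign_mul_self_cast, one_smul]]
  rw [Finset.sum_const, Nat.cast_smul_eq_nsmul]

theorem kappa_polytabloid {μ : n.Partition} (T : Tableau μ) :
    kappa T (polytabloid T) = ((columnGroup T).card : ℂ) • polytabloid T := by
  rw [polytabloid_eq_kappa, kappa_kappa]

/-- Only the identity preserves both the rows and the columns of `T`, so no cancellation occurs at
this coefficient. -/
theorem polytabloid_apply_rowFn {μ : n.Partition} (T : Tableau μ) :
    polytabloid T (rowFn T) = 1 := by
  rw [polytabloid_eq_kappa, kappa_apply, Finsupp.finsetSum_apply,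
    Finset.sum_eq_single_of_mem 1 (one_mem_columnGroup T)]
  · simp
  · intro σ hσ h1
    rw [tabloidRep_single, Finsupp.smul_apply, Finsupp.single_eq_of_ne, smul_zero]
    intro h
    apply h1
    rw [← inv_inj, inv_one]
    ext1 k
    exact ext_rowFn_colFn T (congrFun h k).symm (mem_columnGroup.mp (inv_mem_columnGroup hσ) k)

theorem polytabloid_ne_zero {μ : n.Partition} (T : Tableau μ) : polytabloid T ≠ 0 := fun h => by
  have := polytabloid_apply_rowFn T
  rw [h] at this
  simp at this

theorem kappa_polytabloid_ne_zero {μ : n.Partition} (T : Tableau μ) :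
    kappa T (polytabloid T) ≠ 0 := by
  rw [kappa_polytabloid]
  refine smul_ne_zero ?_ (polytabloid_ne_zero T)
  exact_mod_cast (Finset.card_pos.mpr ⟨1, one_mem_columnGroup T⟩).ne'

theorem specht_le_span_tabloids (ν : n.Partition) :
    (specht ν).toSubmodule ≤
      Submodule.span ℂ (Set.range fun S : Tableau ν => Finsupp.single (rowFn S) (1 : ℂ)) := by
  refine Submodule.span_le.mpr ?_
  rintro _ ⟨S, rfl⟩
  simp only [polytabloid_eq_kappa, kappa_apply]
  refine Submodule.sum_mem _ fun σ _ => Submodule.smul_mem _ _ ?_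
  rw [tabloidRep_single]
  exact Submodule.subset_span ⟨σ⁻¹.trans S, rfl⟩

/-- The numerical invariant `rowSum` replaces the dominance order. Nonvanishing makes the rows of
`S` distinct on each column of `T`, which bounds the row sum; at equality the tabloid of `S` is a
column permutation of that of `T`, so the image is a signed polytabloid. -/
theorem kappa_tabloid {μ ν : n.Partition} (T : Tableau μ) (S : Tableau ν)
    (h : kappa T (Finsupp.single (rowFn S) 1) ≠ 0) :
    rowSum μ ≤ rowSum ν ∧ (rowSum ν = rowSum μ → ν = μ ∧
      kappa T (Finsupp.single (rowFn S) 1) ∈ Submodule.span ℂ {polytabloid T}) := by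
  have ht : ∀ k l, colFn T k = colFn T l → rowFn S k = rowFn S l → k = l := by
    intro k l hc hr
    by_contra hkl
    exact h (kappa_single_eq_zero hkl hc hr 1)
  rw [← sum_rowFn S]
  refine ⟨rowSum_le_of_injective_on_columns T _ ht, fun hs => ?_⟩
  obtain ⟨σ, hσ, hS⟩ := exists_columnGroup_of_sum_eq T _ ht hs
  refine ⟨eq_of_rowFn_eq_comp T S _ hS, ?_⟩
  rw [hS, ← tabloidRep_single, kappa_tabloidRep hσ, ← polytabloid_eq_kappa]
  exact Submodule.smul_mem _ _ (Submodule.mem_span_singleton_self _)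

/-- The hypothesis is the negation of what `kappa_tabloid` would force on a tabloid of shape `ν`
that survives. -/
theorem kappa_specht_eq_zero {μ ν : n.Partition} (T : Tableau μ)
    (h : rowSum μ ≤ rowSum ν → rowSum ν = rowSum μ ∧ ν ≠ μ) {v : (Fin n → ℕ) →₀ ℂ}
    (hv : v ∈ (specht ν).toSubmodule) : kappa T v = 0 := by
  have hle : Submodule.span ℂ (Set.range fun S : Tableau ν => Finsupp.single (rowFn S) (1 : ℂ))
      ≤ LinearMap.ker (kappa T) := by
    refine Submodule.span_le.mpr ?_
    rintro _ ⟨S, rfl⟩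
    by_contra hne
    obtain ⟨h1, h2⟩ := kappa_tabloid T S hne
    exact (h h1).2 (h2 (h h1).1).1
  exact hle (specht_le_span_tabloids ν hv)

theorem kappa_specht_mem {μ : n.Partition} (T : Tableau μ) {v : (Fin n → ℕ) →₀ ℂ}
    (hv : v ∈ (specht μ).toSubmodule) : kappa T v ∈ Submodule.span ℂ {polytabloid T} := by
  have hle : Submodule.span ℂ (Set.range fun S : Tableau μ => Finsupp.single (rowFn S) (1 : ℂ))
      ≤ (Submodule.span ℂ {polytabloid T}).comap (kappa T) := by
    refine Submodule.span_le.mpr ?_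
    rintro _ ⟨S, rfl⟩
    by_cases hne : kappa T (Finsupp.single (rowFn S) 1) = 0
    · simp [hne]
    · exact ((kappa_tabloid T S hne).2 rfl).2
  exact hle (specht_le_span_tabloids μ hv)

/-- The standard bilinear form on the permutation module. -/
def form (n : ℕ) : LinearMap.BilinForm ℂ ((Fin n → ℕ) →₀ ℂ) :=
  LinearMap.mk₂ ℂ (fun u v => Finsupp.linearCombination ℂ (⇑v) u)
    (fun u u' v => map_add _ u u') (fun a u v => map_smul _ a u)
    (fun u v v' => by
      simp [Finsupp.linearCombination_apply, mul_add, Finsupp.sum_add])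
    (fun a u v => by
      simp [Finsupp.linearCombination_apply, Finsupp.sum, Finset.mul_sum, mul_left_comm])

theorem form_apply (u v : (Fin n → ℕ) →₀ ℂ) : form n u v = u.sum fun t a => a * v t := by
  simp [form, Finsupp.linearCombination_apply]

theorem form_single_left (t : Fin n → ℕ) (a : ℂ) (v : (Fin n → ℕ) →₀ ℂ) :
    form n (Finsupp.single t a) v = a * v t := by
  simp [form_apply]

theorem form_comm (u v : (Fin n → ℕ) →₀ ℂ) : form n u v = form n v u := by
  induction u using Finsupp.induction_linear with
  | zero => simp
  | add u u' h h' => simp [h, h']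
  | single t a =>
    rw [form_single_left, form_apply, Finsupp.sum, Finset.sum_eq_single t]
    · simp [mul_comm]
    · intro s _ hs
      rw [Finsupp.single_eq_of_ne hs, mul_zero]
    · intro ht
      rw [Finsupp.notMem_support_iff.mp ht, zero_mul]

theorem form_tabloidRep (σ : Equiv.Perm (Fin n)) (u v : (Fin n → ℕ) →₀ ℂ) :
    form n (tabloidRep n σ u) (tabloidRep n σ v) = form n u v := by
  induction u using Finsupp.induction_linear with
  | zero => simp
  | add u u' h h' => simp [h, h']
  | single t a =>
    rw [tabloidRep_single, form_single_left, form_single_left]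
    congr 1
    exact Finsupp.mapDomain_apply
      (fun s s' h => by
        funext k
        simpa using congrFun h (σ k)) v t

theorem form_tabloidRep_left (σ : Equiv.Perm (Fin n)) (u v : (Fin n → ℕ) →₀ ℂ) :
    form n (tabloidRep n σ u) v = form n u (tabloidRep n σ⁻¹ v) := by
  rw [← form_tabloidRep σ u, ← Module.End.mul_apply, ← map_mul]
  simp

theorem form_kappa {μ : n.Partition} (T : Tableau μ) (u v : (Fin n → ℕ) →₀ ℂ) :
    form n (kappa T u) v = form n u (kappa T v) := by
  rw [kappa_apply, kappa_apply, map_sum, map_sum, LinearMap.sum_apply]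
  refine Finset.sum_bij (fun σ _ => σ⁻¹) (fun σ hσ => inv_mem_columnGroup hσ)
    (fun σ _ σ' _ h => inv_injective h)
    (fun σ hσ => ⟨σ⁻¹, inv_mem_columnGroup hσ, inv_inv σ⟩) ?_
  intro σ _
  rw [map_smul, map_smul, LinearMap.smul_apply, form_tabloidRep_left, Equiv.Perm.sign_inv]

/-- Complex conjugation of the coefficients. -/
def conjMap (n : ℕ) : ((Fin n → ℕ) →₀ ℂ) →+ ((Fin n → ℕ) →₀ ℂ) :=
  Finsupp.mapRange.addMonoidHom (starRingEnd ℂ).toAddMonoidHom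

theorem conjMap_apply (v : (Fin n → ℕ) →₀ ℂ) (t : Fin n → ℕ) :
    conjMap n v t = starRingEnd ℂ (v t) := rfl

/-- Polytabloids have real coefficients, so their complex span is stable under conjugation. -/
theorem conjMap_mem_specht {μ : n.Partition} {v : (Fin n → ℕ) →₀ ℂ}
    (hv : v ∈ (specht μ).toSubmodule) : conjMap n v ∈ (specht μ).toSubmodule := by
  have hv' : v ∈ Submodule.span ℂ (Set.range fun T : Tableau μ => polytabloid T) := hv
  induction hv' using Submodule.span_induction with
  | mem x hx =>
    obtain ⟨T, rfl⟩ := hx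
    have h : conjMap n (polytabloid T) = polytabloid T := by
      ext t
      simp only [conjMap_apply, polytabloid, Finsupp.finsetSum_apply, map_sum,
        Finsupp.smul_apply, smul_eq_mul, map_mul, tabloidRep_single]
      refine Finset.sum_congr rfl fun σ _ => ?_
      congr 1
      · simp
      · classical
        rw [Finsupp.single_apply]
        split_ifs <;> simp
    rw [h]
    exact hv
  | zero => simp
  | add x y hx hy h h' => rw [map_add]; exact Submodule.add_mem _ (h hx) (h' hy)
  | smul a x hx h =>
    have h1 : conjMap n (a • x) = starRingEnd ℂ a • conjMap n x := by
      ext t; simp [conjMap_apply]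
    rw [h1]
    exact Submodule.smul_mem _ _ (h hx)

/-- The bilinear form is not definite over `ℂ`, but pairing with the conjugate gives `∑ |v t|²`. -/
theorem eq_zero_of_form_conjMap {v : (Fin n → ℕ) →₀ ℂ} (h : form n v (conjMap n v) = 0) :
    v = 0 := by
  rw [form_apply, Finsupp.sum] at h
  simp only [conjMap_apply, Complex.mul_conj] at h
  rw [← Complex.ofReal_sum, Complex.ofReal_eq_zero,
    Finset.sum_eq_zero_iff_of_nonneg fun t _ => Complex.normSq_nonneg _] at h
  ext t
  by_contra ht
  exact ht (Complex.normSq_eq_zero.mp (h t (Finsupp.mem_support_iff.mpr ht)))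

theorem polytabloid_mem_specht {μ : n.Partition} (T : Tableau μ) :
    polytabloid T ∈ (specht μ).toSubmodule := Submodule.subset_span ⟨T, rfl⟩

theorem exists_perm_trans {μ : n.Partition} (T S : Tableau μ) :
    ∃ τ : Equiv.Perm (Fin n), τ⁻¹.trans T = S :=
  ⟨(S.trans T.symm)⁻¹, by ext1 k; simp⟩

/-- James's submodule theorem for submodules of a Specht module. -/
theorem eq_bot_or_specht_le {μ : n.Partition} (U : Submodule ℂ ((Fin n → ℕ) →₀ ℂ))
    (hU : ∀ σ, ∀ u ∈ U, tabloidRep n σ u ∈ U) (hle : U ≤ (specht μ).toSubmodule) :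
    U = ⊥ ∨ (specht μ).toSubmodule ≤ U := by
  -- If some signed column sum acts nontrivially on `U`, then `U` contains a polytabloid and hence
  -- all of them. Otherwise self-adjointness of `kappa` makes `U` orthogonal to the Specht module,
  -- which contains the conjugate of each `u ∈ U`.
  by_cases h : ∃ u ∈ U, ∃ T : Tableau μ, kappa T u ≠ 0
  · right
    obtain ⟨u, hu, T, hT⟩ := h
    have hk : kappa T u ∈ U := by
      rw [kappa_apply]
      exact Submodule.sum_mem _ fun σ _ => Submodule.smul_mem _ _ (hU σ u hu)
    obtain ⟨a, ha⟩ := Submodule.mem_span_singleton.mp (kappa_specht_mem T (hle hu))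
    have ha0 : a ≠ 0 := fun h0 => hT (by rw [← ha, h0, zero_smul])
    have hp : polytabloid T ∈ U := by
      have := U.smul_mem a⁻¹ (ha ▸ hk)
      rwa [smul_smul, inv_mul_cancel₀ ha0, one_smul] at this
    refine Submodule.span_le.mpr ?_
    rintro _ ⟨S, rfl⟩
    obtain ⟨τ, rfl⟩ := exists_perm_trans T S
    change polytabloid (μ := μ) (τ⁻¹.trans T) ∈ U
    rw [← tabloidRep_polytabloid]
    exact hU τ _ hp
  · left
    push Not at h
    refine (Submodule.eq_bot_iff U).mpr fun u hu => ?_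
    have hperp : ∀ v ∈ (specht μ).toSubmodule, form n u v = 0 := by
      intro v hv
      have hle' : (specht μ).toSubmodule ≤ LinearMap.ker (form n u) := by
        refine Submodule.span_le.mpr ?_
        rintro _ ⟨T, rfl⟩
        change form n u (polytabloid T) = 0
        rw [polytabloid_eq_kappa, ← form_kappa, h u hu T]
        simp
      exact hle' hv
    exact eq_zero_of_form_conjMap (hperp _ (conjMap_mem_specht (hle hu)))

/-- Specht modules are irreducible. -/
theorem isIrreducible_specht (μ : n.Partition) :
    Representation.IsIrreducible (k := ℂ) (V := ↥(specht μ).toSubmodule)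
      (specht μ).toRepresentation := by
  obtain ⟨T⟩ := nonempty_tableau μ
  refine { exists_pair_ne := ⟨⊥, ⊤, fun h => ?_⟩, eq_bot_or_eq_top := fun W => ?_ }
  · have hm : (⟨polytabloid T, polytabloid_mem_specht T⟩ : (specht μ).toSubmodule) ∈
        (⊥ : Subrepresentation (specht μ).toRepresentation).toSubmodule := by
      rw [h]; trivial
    exact polytabloid_ne_zero T (congrArg Subtype.val ((Submodule.mem_bot ℂ).mp hm))
  · have h := eq_bot_or_specht_le (μ := μ) (W.toSubmodule.map (specht μ).toSubmodule.subtype)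
      (by
        rintro σ _ ⟨w, hw, rfl⟩
        exact ⟨_, W.apply_mem_toSubmodule σ hw, rfl⟩)
      (by
        rintro _ ⟨w, hw, rfl⟩
        exact w.2)
    rcases h with h | h
    · left
      apply Subrepresentation.toSubmodule_injective
      exact Submodule.map_injective_of_injective (f := (specht μ).toSubmodule.subtype)
        Subtype.val_injective (h.trans (Submodule.map_bot _).symm)
    · right
      apply Subrepresentation.toSubmodule_injective
      refine eq_top_iff.mpr fun w _ => ?_
      obtain ⟨w', hw', h'⟩ := h w.2
      rwa [← Subtype.val_injective h']

/-- An equivalence commutes with `kappa T`, a combination of group elements. Since `kappa T` does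
not kill `e_T`, it does not kill its image in `S^ν`. Using this in both directions gives equality of
row sums. -/
theorem rowSum_le_of_equiv {μ ν : n.Partition}
    (φ : (specht μ).toRepresentation.Equiv (specht ν).toRepresentation) :
    rowSum μ ≤ rowSum ν ∧ (rowSum ν = rowSum μ → ν = μ) := by
  obtain ⟨T⟩ := nonempty_tableau μ
  have hcomm : ∀ v : (specht μ).toSubmodule, ∀ w : (specht μ).toSubmodule,
      (w : (Fin n → ℕ) →₀ ℂ) = kappa T v → ((φ w : (specht ν).toSubmodule) : _ →₀ ℂ) =
        kappa T (φ v : (specht ν).toSubmodule) := by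
    intro v w hw
    have hw' : w = ∑ σ ∈ columnGroup T,
        ((Equiv.Perm.sign σ : ℤ) : ℂ) • (specht μ).toRepresentation σ v := by
      apply Subtype.val_injective
      rw [hw, kappa_apply]
      simp [Subrepresentation.toRepresentation]
    rw [hw', map_sum, kappa_apply, AddSubmonoidClass.coe_finsetSum]
    refine Finset.sum_congr rfl fun σ _ => ?_
    have hφ : φ ((specht μ).toRepresentation σ v) = (specht ν).toRepresentation σ (φ v) :=
      LinearMap.congr_fun (φ.toIntertwiningMap.isIntertwining' σ) v
    rw [map_smul, hφ]
    rfl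
  set e : (specht μ).toSubmodule := ⟨polytabloid T, polytabloid_mem_specht T⟩
  have h1 := hcomm e (((columnGroup T).card : ℂ) • e) (kappa_polytabloid T).symm
  have h2 : kappa T (φ e : (specht ν).toSubmodule) ≠ 0 := by
    rw [← h1]
    intro h
    have h3 : ((columnGroup T).card : ℂ) • e = 0 := by
      apply φ.injective
      rw [map_zero]
      exact Subtype.val_injective h
    refine kappa_polytabloid_ne_zero T ?_
    rw [kappa_polytabloid]
    exact congrArg Subtype.val h3
  by_contra hcon
  refine h2 (kappa_specht_eq_zero T (fun h => ?_) (φ e).2)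
  rw [not_and] at hcon
  exact Classical.not_imp.mp (hcon h)

/-- Specht modules of different partitions are not isomorphic. -/
theorem eq_of_equiv {μ ν : n.Partition}
    (φ : (specht μ).toRepresentation.Equiv (specht ν).toRepresentation) : μ = ν := by
  have h1 := rowSum_le_of_equiv φ
  have h2 := rowSum_le_of_equiv φ.symm
  exact (h1.2 (le_antisymm h2.1 h1.1)).symm

end SymDim
end

/-! ### Frobenius-Schur indicators and expansion of class functions. -/

noncomputable section

namespace Representation

open Module

section FrobeniusSchur

variable {G V : Type*} [Group G] [AddCommGroup V] [Module ℂ V]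
  [FiniteDimensional ℂ V] {ρ : Representation ℂ G V}

/-- Schur's lemma for endomorphisms. -/
theorem exists_smul_of_commute (hρ : ρ.IsIrreducible) (f : V →ₗ[ℂ] V)
    (hf : ∀ g v, f (ρ g v) = ρ g (f v)) : ∃ c : ℂ, ∀ v, f v = c • v := by
  obtain ⟨c, hc⟩ := (IsIrreducible.algebraMap_intertwiningMap_bijective_of_isAlgClosed
    (ρ := ρ)).surjective (f.intertwiningMap_of_isIntertwiningMap ρ ρ hf)
  refine ⟨c, fun v => ?_⟩
  have := congrArg (fun φ : IntertwiningMap ρ ρ => φ v) hc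
  exact this.symm

theorem finrank_ne_zero_of_isIrreducible (hρ : ρ.IsIrreducible) : finrank ℂ V ≠ 0 := by
  intro h
  have h0 := finrank_zero_iff.mp h
  obtain ⟨W, W', hW⟩ := hρ.exists_pair_ne
  exact hW (Subrepresentation.toSubmodule_injective (Subsingleton.elim _ _))

variable [Fintype G]

/-- The average of the conjugates of the rank-one map `x ↦ f x • u` is scalar by Schur's lemma; its
trace `|G| f u` determines the scalar. -/
theorem sum_apply_inv_smul_apply (hρ : ρ.IsIrreducible) (f : V →ₗ[ℂ] ℂ) (u x : V) :
    ∑ h : G, f (ρ h⁻¹ x) • ρ h u = ((Fintype.card G : ℂ) * f u / finrank ℂ V) • x := by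
  have hd : (finrank ℂ V : ℂ) ≠ 0 := by exact_mod_cast finrank_ne_zero_of_isIrreducible hρ
  set F : V →ₗ[ℂ] V := ∑ h : G, ρ h * (f.smulRight u * ρ h⁻¹) with hF
  have hFx : ∀ x, F x = ∑ h : G, f (ρ h⁻¹ x) • ρ h u := fun x => by
    simp [hF, LinearMap.sum_apply]
  obtain ⟨c, hc⟩ := exists_smul_of_commute hρ F fun g v => by
    rw [hFx, hFx, map_sum]
    refine Fintype.sum_equiv (Equiv.mulLeft g⁻¹) _ _ fun h => ?_
    rw [map_smul, ← Module.End.mul_apply, ← Module.End.mul_apply, ← map_mul, ← map_mul]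
    simp
  have ht : LinearMap.trace ℂ V F = Fintype.card G * f u := by
    rw [hF, map_sum, Finset.sum_congr rfl fun h _ => by
      rw [LinearMap.trace_mul_comm, mul_assoc, ← map_mul, inv_mul_cancel, map_one, mul_one,
        LinearMap.trace_smulRight]]
    simp
  have hF' : F = c • LinearMap.id := LinearMap.ext fun v => by simp [hc]
  rw [hF', map_smul, LinearMap.trace_id, smul_eq_mul] at ht
  rw [← hFx, hc, ← ht, mul_div_cancel_right₀ _ hd]

/-- An irreducible representation with a nondegenerate invariant symmetric bilinear form has
Frobenius-Schur indicator `1`. -/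
theorem sum_character_mul_self (hρ : ρ.IsIrreducible) (B : LinearMap.BilinForm ℂ V)
    (hsymm : ∀ u v, B u v = B v u) (hnd : ∀ u, (∀ v, B u v = 0) → u = 0)
    (hinv : ∀ g u v, B (ρ g u) (ρ g v) = B u v) :
    ∑ h : G, ρ.character (h * h) = Fintype.card G := by
  have hd : (finrank ℂ V : ℂ) ≠ 0 := by exact_mod_cast finrank_ne_zero_of_isIrreducible hρ
  have : Invertible (2 : ℂ) := invertibleOfNonzero two_ne_zero
  obtain ⟨b, hb⟩ := LinearMap.BilinForm.exists_orthogonal_basis (B := B) ⟨hsymm⟩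
  rw [LinearMap.isOrthoᵢ_def] at hb
  set q : Fin (finrank ℂ V) → ℂ := fun i => B (b i) (b i) with hq
  have hBb : ∀ i v, B (b i) v = q i * b.repr v i := fun i v => by
    conv_lhs => rw [← b.sum_repr v, map_sum]
    rw [Finset.sum_eq_single i]
    · rw [map_smul, smul_eq_mul, mul_comm]
    · intro j _ hj
      rw [map_smul, hb i j hj.symm, smul_zero]
    · simp
  have hq0 : ∀ i, q i ≠ 0 := fun i h => b.ne_zero i (hnd _ fun v => by rw [hBb, h, zero_mul])
  have hrepr : ∀ v i, b.repr v i = (q i)⁻¹ * B (b i) v := fun v i => by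
    rw [hBb, inv_mul_cancel_left₀ (hq0 i)]
  -- Invariance moves one factor `h` across the form as `h⁻¹`, so the sum over `G` becomes an
  -- instance of the averaging identity.
  have htr : ∀ h : G, ρ.character (h * h) =
      ∑ i, ∑ j, (q i)⁻¹ * (q j)⁻¹ * (B (b j) (ρ h⁻¹ (b i)) * B (b j) (ρ h (b i))) := fun h => by
    rw [character, LinearMap.trace_eq_matrix_trace ℂ b, Matrix.trace]
    refine Finset.sum_congr rfl fun i _ => ?_
    have h1 : B (b i) (ρ (h * h) (b i)) = B (ρ h⁻¹ (b i)) (ρ h (b i)) := by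
      rw [← hinv h⁻¹, ← Module.End.mul_apply, ← map_mul, inv_mul_cancel_left]
    rw [Matrix.diag_apply, LinearMap.toMatrix_apply, hrepr, h1]
    conv_lhs => rw [← b.sum_repr (ρ h⁻¹ (b i)), map_sum, LinearMap.sum_apply, Finset.mul_sum]
    refine Finset.sum_congr rfl fun j _ => ?_
    rw [map_smul, LinearMap.smul_apply, hrepr, smul_eq_mul]
    ring
  have hsum : ∀ i j, ∑ h : G, B (b j) (ρ h⁻¹ (b i)) * B (b j) (ρ h (b i)) =
      Fintype.card G * B (b j) (b i) / finrank ℂ V * B (b j) (b i) := fun i j => by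
    have h := congrArg (B (b j)) (sum_apply_inv_smul_apply hρ (B (b j)) (b i) (b i))
    simpa using h
  simp_rw [htr]
  rw [Finset.sum_comm, Finset.sum_congr rfl fun i _ => Finset.sum_comm]
  simp_rw [← Finset.mul_sum, hsum]
  -- Orthogonality leaves only `j = i`, so each `i` contributes `|G| / dim V`, and there are `dim V`
  -- of them.
  have hdiag : ∀ i, ∑ j, (q i)⁻¹ * (q j)⁻¹ *
      (Fintype.card G * B (b j) (b i) / finrank ℂ V * B (b j) (b i)) =
        (Fintype.card G : ℂ) / finrank ℂ V := fun i => by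
    rw [Finset.sum_eq_single i]
    · change (q i)⁻¹ * (q i)⁻¹ * (Fintype.card G * q i / finrank ℂ V * q i) = _
      have := hq0 i
      field_simp
    · intro j _ hj
      rw [hb j i hj]
      simp
    · simp
  rw [Finset.sum_congr rfl fun i _ => hdiag i]
  simp only [Finset.sum_const, Finset.card_univ, Fintype.card_fin, nsmul_eq_mul]
  field_simp

end FrobeniusSchur

section ClassFunctions

variable {G ι : Type*} [Group G] [Fintype G] {V : ι → Type*}
  [∀ i, AddCommGroup (V i)] [∀ i, Module ℂ (V i)] [∀ i, FiniteDimensional ℂ (V i)]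
  {ρ : ∀ i, Representation ℂ G (V i)}

theorem sum_character_mul_character_inv [DecidableEq ι] (hρ : ∀ i, (ρ i).IsIrreducible)
    (hne : ∀ i j, Nonempty ((ρ i).Equiv (ρ j)) → i = j) (i j : ι) :
    ∑ g : G, (ρ i).character g * (ρ j).character g⁻¹ =
      if i = j then (Fintype.card G : ℂ) else 0 := by
  have hG : (Nat.card G : ℂ) ≠ 0 := by exact_mod_cast Nat.card_pos.ne'
  have : Invertible (Nat.card G : ℂ) := invertibleOfNonzero hG
  have := hρ i
  have := hρ j
  have h := char_orthonormal (ρ i) (ρ j)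
  rw [inv_mul_eq_iff_eq_mul₀ hG] at h
  rw [h, ← Nat.card_eq_fintype_card]
  split_ifs with h1 h2 h2
  · rw [mul_one]
  · exact absurd (hne _ _ h1).symm h2
  · subst h2
    exact absurd ⟨Equiv.refl _⟩ h1
  · rw [mul_zero]

variable [Fintype ι]

/-- If there are at least as many pairwise non-isomorphic irreducible representations as there
are conjugacy classes, then class functions expand in their characters. -/
theorem class_function_eq_sum_character (hρ : ∀ i, (ρ i).IsIrreducible)
    (hne : ∀ i j, Nonempty ((ρ i).Equiv (ρ j)) → i = j)
    (hcard : Nat.card (ConjClasses G) ≤ Fintype.card ι) (f : G → ℂ)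
    (hf : ∀ g h, f (h * g * h⁻¹) = f g) (g : G) :
    Fintype.card G * f g =
      ∑ i, (∑ h : G, f h * (ρ i).character h⁻¹) * (ρ i).character g := by
  classical
  have hlift : ∀ φ : G → ℂ, (∀ g h, φ (h * g * h⁻¹) = φ g) →
      ∃ F : ConjClasses G → ℂ, ∀ g, F (ConjClasses.mk g) = φ g := fun φ hφ =>
    ⟨Quotient.lift φ fun a b hab => by
      obtain ⟨c, rfl⟩ := isConj_iff.mp hab
      exact (hφ a c).symm, fun g => rfl⟩
  obtain ⟨F, hF⟩ := hlift f hf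
  choose X hX using fun i => hlift (ρ i).character fun g h => char_conj (ρ i) g h
  have hpair : ∀ (a : ι → ℂ) (j : ι), ∑ h : G, (∑ i, a i * (ρ i).character h) *
      (ρ j).character h⁻¹ = Fintype.card G * a j := by
    intro a j
    simp_rw [Finset.sum_mul, mul_assoc]
    rw [Finset.sum_comm]
    simp_rw [← Finset.mul_sum, sum_character_mul_character_inv hρ hne]
    simp [mul_comm]
  have hG : (Fintype.card G : ℂ) ≠ 0 := by exact_mod_cast Fintype.card_ne_zero
  -- Characters are viewed on conjugacy classes: orthogonality makes them independent, and `hcard`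
  -- then makes them a basis.
  have hli : LinearIndependent ℂ X := by
    rw [Fintype.linearIndependent_iff]
    intro a ha j
    have h := hpair a j
    have h0 : ∀ h : G, ∑ i, a i * (ρ i).character h = 0 := fun h => by
      have := congrFun ha (ConjClasses.mk h)
      simpa [hX] using this
    simp_rw [h0] at h
    simpa [hG] using h
  have : Fintype (ConjClasses G) := Fintype.ofFinite _
  have hspan : Submodule.span ℂ (Set.range X) = ⊤ := by
    apply Submodule.eq_top_of_finrank_eq
    apply le_antisymm (Submodule.finrank_le _)
    rw [finrank_span_eq_card hli, finrank_fintype_fun_eq_card, ← Nat.card_eq_fintype_card]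
    exact hcard
  have hFX : F ∈ Submodule.span ℂ (Set.range X) := hspan ▸ Submodule.mem_top
  obtain ⟨a, ha⟩ := (Submodule.mem_span_range_iff_exists_fun ℂ).mp hFX
  have hfa : ∀ h, f h = ∑ i, a i * (ρ i).character h := fun h => by
    rw [← hF, ← ha]
    simp [hX]
  have hcoef : ∀ j, ∑ h : G, f h * (ρ j).character h⁻¹ = Fintype.card G * a j := fun j => by
    rw [← hpair a j]
    simp_rw [hfa]
  simp_rw [hcoef]
  rw [hfa, Finset.mul_sum]
  simp_rw [mul_assoc]

/-- Expand the indicator of the identity in characters and evaluate at `1`. -/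
theorem sum_finrank_sq (hρ : ∀ i, (ρ i).IsIrreducible)
    (hne : ∀ i j, Nonempty ((ρ i).Equiv (ρ j)) → i = j)
    (hcard : Nat.card (ConjClasses G) ≤ Fintype.card ι) :
    ∑ i, finrank ℂ (V i) ^ 2 = Fintype.card G := by
  classical
  have h := class_function_eq_sum_character hρ hne hcard (fun g => if g = 1 then 1 else 0)
    (fun g h => by simp) 1
  have h' : (Fintype.card G : ℂ) = ∑ i, (finrank ℂ (V i) : ℂ) ^ 2 := by
    simpa [sq] using h
  exact_mod_cast h'.symm

/-- Expand the number of square roots of `g`: its pairing with each character is a Frobenius-Schur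
sum, here `|G|`. Evaluate at `1`. -/
theorem sum_finrank (hρ : ∀ i, (ρ i).IsIrreducible)
    (hne : ∀ i j, Nonempty ((ρ i).Equiv (ρ j)) → i = j)
    (hcard : Nat.card (ConjClasses G) ≤ Fintype.card ι)
    (hfs : ∀ i, ∑ h : G, (ρ i).character (h * h) = Fintype.card G) [DecidableEq G] :
    ∑ i, finrank ℂ (V i) = (Finset.univ.filter fun h : G => h * h = 1).card := by
  have hG : (Fintype.card G : ℂ) ≠ 0 := by exact_mod_cast Fintype.card_ne_zero
  have h := class_function_eq_sum_character hρ hne hcard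
    (fun g => ∑ h : G, if h * h = g then 1 else 0)
    (fun g k => Fintype.sum_equiv (MulAut.conj k⁻¹).toEquiv _ _ fun h => by
      have : h * h = k * g * k⁻¹ ↔ k⁻¹ * h * k * (k⁻¹ * h * k) = g := by
        rw [← mul_left_inj k, ← mul_right_inj k⁻¹]
        simp [mul_assoc]
      simp [this]) 1
  have hc : ∀ i, ∑ g : G, (∑ h : G, if h * h = g then 1 else 0) * (ρ i).character g⁻¹ =
      Fintype.card G := fun i => by
    rw [← hfs i]
    simp_rw [Finset.sum_mul]
    rw [Finset.sum_comm]
    simp only [ite_mul, one_mul, zero_mul, Finset.sum_ite_eq, Finset.mem_univ, if_true]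
    exact Fintype.sum_equiv (Equiv.inv G) _ _ fun h => by simp
  simp_rw [hc] at h
  rw [← Finset.mul_sum] at h
  have h' := mul_left_cancel₀ hG h
  simp only [char_one, Finset.sum_boole] at h'
  exact_mod_cast h'.symm

end ClassFunctions

end Representation

end

/-! ### Sums of dimensions and the growth of the number of involutions. -/

noncomputable section

namespace SymDim

variable {n : ℕ}

/-- The underlying space of the Specht module. -/
def SpechtModule (μ : n.Partition) : Type := ↥(specht μ).toSubmodule

instance (μ : n.Partition) : AddCommGroup (SpechtModule μ) :=
  inferInstanceAs (AddCommGroup ↥(specht μ).toSubmodule)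

instance (μ : n.Partition) : Module ℂ (SpechtModule μ) :=
  inferInstanceAs (Module ℂ ↥(specht μ).toSubmodule)

instance (μ : n.Partition) : FiniteDimensional ℂ (SpechtModule μ) :=
  FiniteDimensional.span_of_finite ℂ (Set.finite_range _)

/-- The action of the symmetric group on the Specht module. -/
def spechtRep (μ : n.Partition) : Representation ℂ (Equiv.Perm (Fin n)) (SpechtModule μ) :=
  (specht μ).toRepresentation

theorem isIrreducible_spechtRep (μ : n.Partition) : (spechtRep μ).IsIrreducible :=
  isIrreducible_specht μ

theorem eq_of_nonempty_equiv (μ ν : n.Partition)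
    (h : Nonempty ((spechtRep μ).Equiv (spechtRep ν))) : μ = ν :=
  h.elim fun φ => eq_of_equiv φ

theorem card_conjClasses_perm_le :
    Nat.card (ConjClasses (Equiv.Perm (Fin n))) ≤ Fintype.card n.Partition := by
  have h : Nat.card (ConjClasses (Equiv.Perm (Fin n))) ≤
      Nat.card (Fintype.card (Fin n)).Partition := by
    refine Nat.card_le_card_of_injective (Quotient.lift
      (fun σ : Equiv.Perm (Fin n) => σ.partition)
      fun σ τ hστ => Equiv.Perm.partition_eq_of_isConj.mp hστ) ?_
    rintro ⟨σ⟩ ⟨τ⟩ hστ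
    exact Quotient.sound (Equiv.Perm.partition_eq_of_isConj.mpr hστ)
  rwa [Fintype.card_fin, Nat.card_eq_fintype_card (α := n.Partition)] at h

theorem sum_dim_sq : ∑ μ : n.Partition, dim μ ^ 2 = n.factorial := by
  have h := Representation.sum_finrank_sq isIrreducible_spechtRep
    eq_of_nonempty_equiv (card_conjClasses_perm_le (n := n))
  rwa [Fintype.card_perm, Fintype.card_fin] at h

/-- The invariant bilinear form of the Specht module. -/
def spechtForm (μ : n.Partition) : LinearMap.BilinForm ℂ (SpechtModule μ) :=
  (form n).restrict (specht μ).toSubmodule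

theorem sum_character_specht_mul_self (μ : n.Partition) :
    ∑ h : Equiv.Perm (Fin n), (spechtRep μ).character (h * h) =
      Fintype.card (Equiv.Perm (Fin n)) := by
  refine Representation.sum_character_mul_self (isIrreducible_spechtRep μ)
    (spechtForm μ) ?_ ?_ ?_
  · intro u v
    exact form_comm u.1 v.1
  · intro u hu
    exact Subtype.val_injective
      (eq_zero_of_form_conjMap (hu ⟨conjMap n u.1, conjMap_mem_specht u.2⟩))
  · intro g u v
    exact form_tabloidRep g u.1 v.1

theorem sum_dim : ∑ μ : n.Partition, dim μ =
    (Finset.univ.filter fun h : Equiv.Perm (Fin n) => h * h = 1).card :=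
  Representation.sum_finrank isIrreducible_spechtRep eq_of_nonempty_equiv
    card_conjClasses_perm_le sum_character_specht_mul_self

/-- `irrepDims` sees only representations on coordinate spaces, so the Specht module is transported
along a basis. -/
theorem dim_le_maxDim (μ : n.Partition) : dim μ ≤ maxDim n := by
  apply (isGreatest_maxDim n).2
  let e : SpechtModule μ ≃ₗ[ℂ] (Fin (dim μ) → ℂ) :=
    (Module.finBasis ℂ (SpechtModule μ)).equivFun
  let ρ : Representation ℂ (Equiv.Perm (Fin n)) (Fin (dim μ) → ℂ) :=
    { toFun := fun g => e.conj (spechtRep μ g)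
      map_one' := by rw [map_one]; exact e.conj_id
      map_mul' := fun g h => by rw [map_mul]; exact e.conj_comp _ _ }
  have hρ : ∀ g v, ρ g v = e (spechtRep μ g (e.symm v)) := fun g v => rfl
  refine ⟨ρ, ?_⟩
  have hirr := isIrreducible_spechtRep μ
  refine { exists_pair_ne := ⟨⊥, ⊤, fun h => ?_⟩, eq_bot_or_eq_top := fun W => ?_ }
  · have h' : (⊥ : Submodule ℂ (Fin (dim μ) → ℂ)) = ⊤ :=
      congrArg Subrepresentation.toSubmodule h
    have h0 := Representation.finrank_ne_zero_of_isIrreducible hirr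
    have h1 : Module.finrank ℂ (⊥ : Submodule ℂ (Fin (dim μ) → ℂ)) = dim μ := by
      rw [h']; simp
    rw [finrank_bot] at h1
    exact h0 h1.symm
  · let W' : Subrepresentation (spechtRep μ) :=
      { toSubmodule := W.toSubmodule.comap e.toLinearMap
        apply_mem_toSubmodule := fun g v hv => by
          have := W.apply_mem_toSubmodule g hv
          simpa [hρ] using this }
    have hWW : W.toSubmodule = W'.toSubmodule.map e.toLinearMap :=
      (Submodule.map_comap_eq_of_surjective e.surjective _).symm
    rcases hirr.eq_bot_or_eq_top W' with h | h
    · left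
      apply Subrepresentation.toSubmodule_injective
      rw [hWW, h]
      exact Submodule.map_bot _
    · right
      apply Subrepresentation.toSubmodule_injective
      rw [hWW, h]
      exact (Submodule.map_top _).trans (LinearMap.range_eq_top.mpr e.surjective)

/-- The number of permutations of `n` letters with square one. -/
def numInvolutions (n : ℕ) : ℕ :=
  (Finset.univ.filter fun h : Equiv.Perm (Fin n) => h * h = 1).card

theorem factorial_le_maxDim_mul : n.factorial ≤ maxDim n * numInvolutions n := by
  rw [← sum_dim_sq, numInvolutions, ← sum_dim, Finset.mul_sum]
  refine Finset.sum_le_sum fun μ _ => ?_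
  rw [sq]
  exact Nat.mul_le_mul_right _ (dim_le_maxDim μ)

theorem card_involutions_eq {α : Type*} [Fintype α] [DecidableEq α] (h : Fintype.card α = n) :
    (Finset.univ.filter fun σ : Equiv.Perm α => σ * σ = 1).card = numInvolutions n := by
  subst h
  let e := (Fintype.equivFin α).permCongrHom
  refine Finset.card_bij (fun σ _ => e σ) ?_ (fun _ _ _ _ h => e.injective h) ?_
  · intro σ hσ
    simp only [Finset.mem_filter, Finset.mem_univ, true_and] at hσ ⊢
    rw [← map_mul, hσ, map_one]
  · intro σ hσ
    simp only [Finset.mem_filter, Finset.mem_univ, true_and] at hσ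
    exact ⟨e.symm σ, by simp [← map_mul, hσ], by simp⟩

/-- Permutations that agree off `p` and preserve `p` are determined by their restrictions to `p`,
again of square one. -/
theorem card_involutions_le_of_forall_fixed {α β : Type*} [Fintype α] [DecidableEq α] [Fintype β]
    [DecidableEq β] (s : Finset (Equiv.Perm α)) (p : α → Prop) [DecidablePred p]
    (hβ : Fintype.card {x // p x} = Fintype.card β)
    (hs : ∀ σ ∈ s, σ * σ = 1 ∧ ∀ x, p (σ x) ↔ p x)
    (heq : ∀ σ ∈ s, ∀ τ ∈ s, ∀ x, ¬ p x → σ x = τ x) :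
    s.card ≤ numInvolutions (Fintype.card β) := by
  rw [← card_involutions_eq hβ]
  refine Finset.card_le_card_of_injOn
    -- The default `1` is never taken on `s`.
    (fun σ => if h : ∀ x, p (σ x) ↔ p x then σ.subtypePerm h else 1) ?_ ?_
  · intro σ hσ
    have h := hs σ hσ
    simp only [Finset.coe_filter, Finset.mem_univ, true_and, Set.mem_ofPred_eq, dif_pos h.2]
    ext x
    simp [h.1]
  · intro σ hσ τ hτ h
    have h1 := hs σ hσ
    have h2 := hs τ hτ
    simp only [dif_pos h1.2, dif_pos h2.2] at h
    ext x
    by_cases hx : p x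
    · exact congrArg Subtype.val (Equiv.ext_iff.mp h ⟨x, hx⟩)
    · exact heq σ hσ τ hτ x hx

/-- Split by the image of `0`: fixed, or swapped with one of `n + 1` letters. -/
theorem numInvolutions_succ_succ_le :
    numInvolutions (n + 2) ≤ numInvolutions (n + 1) + (n + 1) * numInvolutions n := by
  have hsplit : numInvolutions (n + 2) = ∑ a : Fin (n + 2), (Finset.univ.filter fun
      σ : Equiv.Perm (Fin (n + 2)) => σ * σ = 1 ∧ σ 0 = a).card := by
    rw [numInvolutions, Finset.card_eq_sum_card_fiberwise
      (f := fun σ : Equiv.Perm (Fin (n + 2)) => σ 0) (t := Finset.univ) (by simp)]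
    simp [Finset.filter_filter]
  rw [hsplit, Fin.sum_univ_succ]
  refine add_le_add ?_ ?_
  · have h := card_involutions_le_of_forall_fixed (β := Fin (n + 1)) (Finset.univ.filter fun
      σ : Equiv.Perm (Fin (n + 2)) => σ * σ = 1 ∧ σ 0 = 0) (fun x => x ≠ 0)
      (by simp) ?_ ?_
    · simpa using h
    · intro σ hσ
      simp only [Finset.mem_filter, Finset.mem_univ, true_and] at hσ
      refine ⟨hσ.1, fun x => not_congr ?_⟩
      conv_lhs => rw [← hσ.2]
      exact σ.injective.eq_iff
    · intro σ hσ τ hτ x hx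
      simp only [Finset.mem_filter, Finset.mem_univ, true_and] at hσ hτ
      obtain rfl : x = 0 := not_not.mp hx
      rw [hσ.2, hτ.2]
  · have h : ∀ a : Fin (n + 1), (Finset.univ.filter fun
      σ : Equiv.Perm (Fin (n + 2)) => σ * σ = 1 ∧ σ 0 = a.succ).card ≤ numInvolutions n := by
      intro a
      have h := card_involutions_le_of_forall_fixed (β := Fin n) (Finset.univ.filter fun
        σ : Equiv.Perm (Fin (n + 2)) => σ * σ = 1 ∧ σ 0 = a.succ)
        (fun x => x ∉ ({0, a.succ} : Finset (Fin (n + 2)))) ?_ ?_ ?_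
      · simpa using h
      · rw [Fintype.card_subtype_compl, Fintype.card_coe,
          Finset.card_pair (Fin.succ_ne_zero a).symm]
        simp
      · intro σ hσ
        simp only [Finset.mem_filter, Finset.mem_univ, true_and] at hσ
        have h' : σ a.succ = 0 := by
          rw [← hσ.2, ← Equiv.Perm.mul_apply, hσ.1]; rfl
        refine ⟨hσ.1, fun x => not_congr ?_⟩
        simp only [Finset.mem_insert, Finset.mem_singleton]
        constructor
        · rintro (hx | hx)
          · exact Or.inr (σ.injective (hx.trans h'.symm))
          · exact Or.inl (σ.injective (hx.trans hσ.2.symm))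
        · rintro (rfl | rfl)
          · exact Or.inr hσ.2
          · exact Or.inl h'
      · intro σ hσ τ hτ x hx
        simp only [Finset.mem_filter, Finset.mem_univ, true_and] at hσ hτ
        have h1 : σ a.succ = 0 := by
          rw [← hσ.2, ← Equiv.Perm.mul_apply, hσ.1]; rfl
        have h2 : τ a.succ = 0 := by
          rw [← hτ.2, ← Equiv.Perm.mul_apply, hτ.1]; rfl
        simp only [Finset.mem_insert, Finset.mem_singleton, not_not] at hx
        rcases hx with rfl | rfl
        · rw [hσ.2, hτ.2]
        · rw [h1, h2]
    refine (Finset.sum_le_sum fun a _ => h a).trans ?_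
    simp

/-- The inductive step of `numInvolutions_le` at `x = n + 1`, after dividing out the common factors.
-/
theorem exp_neg_inv_sqrt_le (x : ℝ) (hx : 1 ≤ x) :
    Real.exp (-(Real.sqrt (x + 1) - Real.sqrt x)) +
      Real.sqrt x * Real.exp (-(Real.sqrt (x + 1) - Real.sqrt (x - 1))) ≤ Real.sqrt (x + 1) := by
  set s := Real.sqrt (x + 1)
  set u := Real.sqrt x
  set w := Real.sqrt (x - 1)
  have hs : s ^ 2 = x + 1 := Real.sq_sqrt (by linarith)
  have hu : u ^ 2 = x := Real.sq_sqrt (by linarith)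
  have hw : w ^ 2 = x - 1 := Real.sq_sqrt (by linarith)
  have hw0 : 0 ≤ w := Real.sqrt_nonneg _
  have hu1 : 1 ≤ u := Real.one_le_sqrt.mpr hx
  have hs0 : 0 ≤ s := Real.sqrt_nonneg _
  have hsu : u < s := Real.sqrt_lt_sqrt (by linarith) (by linarith)
  -- Uses `(1 + y + y²/2)(1 - y + y²/2) = 1 + y⁴/4 ≥ 1`.
  have hexp : ∀ y : ℝ, 0 ≤ y → Real.exp (-y) ≤ 1 - y + y ^ 2 / 2 := fun y hy => by
    have h := Real.quadratic_le_exp_of_nonneg hy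
    rw [Real.exp_neg, inv_le_iff_one_le_mul₀ (Real.exp_pos y)]
    have h0 : 0 ≤ 1 - y + y ^ 2 / 2 := by nlinarith [sq_nonneg (y - 1)]
    nlinarith [mul_le_mul_of_nonneg_left h h0, pow_nonneg hy 4]
  have hus : 0 < u := by linarith
  have hss : 0 < s := by linarith
  have h1 : Real.exp (-(s - u)) ≤ 1 - 1 / (2 * s) + 1 / (8 * s ^ 2) := by
    have hle : 1 / (2 * s) ≤ s - u := by
      rw [div_le_iff₀ (by positivity)]
      nlinarith
    refine (Real.exp_le_exp.mpr (neg_le_neg hle)).trans ((hexp _ (by positivity)).trans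
      (le_of_eq ?_))
    field_simp
    ring
  have h2 : u * Real.exp (-(s - w)) ≤ u - 1 + 1 / (2 * u) := by
    have hle : 1 / u ≤ s - w := by
      have hsw : s + w ≤ 2 * u := by nlinarith [sq_nonneg (s - w), sq_nonneg (s + w)]
      rw [div_le_iff₀ hus]
      nlinarith
    refine (mul_le_mul_of_nonneg_left ((Real.exp_le_exp.mpr (neg_le_neg hle)).trans
      (hexp _ (by positivity))) hus.le).trans (le_of_eq ?_)
    field_simp
  -- Adding `h1` and `h2` cancels the constants; the remaining error must fit in `s - u = 1/(s +
  -- u)`, and each of its two pieces takes at most half.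
  have h3 : 1 / (2 * u) - 1 / (2 * s) + 1 / (8 * s ^ 2) ≤ s - u := by
    have hd : s - u = 1 / (s + u) := by
      rw [eq_div_iff (by positivity)]
      nlinarith
    have h4 : 1 / (2 * u) - 1 / (2 * s) = (s - u) / (2 * u * s) := by
      field_simp
    have h5 : (s - u) / (2 * u * s) ≤ (s - u) / 2 :=
      div_le_div_of_nonneg_left (by linarith) (by norm_num) (by nlinarith)
    have h6 : 1 / (8 * s ^ 2) ≤ (s - u) / 2 := by
      rw [hd, div_div, div_le_div_iff₀ (by positivity) (by positivity)]
      nlinarith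
    linarith
  linarith

theorem numInvolutions_le : (numInvolutions n : ℝ) ≤
    Real.sqrt n.factorial * Real.exp (Real.sqrt n) := by
  induction n using Nat.twoStepInduction with
  | zero =>
    have h : numInvolutions 0 = 1 := by decide
    rw [h]
    simp
  | one =>
    have h : numInvolutions 1 = 1 := by decide
    rw [h]
    simp
  | more n ih0 ih1 =>
    have hrec : (numInvolutions (n + 2) : ℝ) ≤
        numInvolutions (n + 1) + (n + 1) * numInvolutions n := by
      exact_mod_cast numInvolutions_succ_succ_le
    have hx := exp_neg_inv_sqrt_le ((n : ℝ) + 1) (by linarith [n.cast_nonneg (α := ℝ)])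
    set s := Real.sqrt ((n : ℝ) + 1 + 1)
    set u := Real.sqrt ((n : ℝ) + 1)
    have hu : u * u = (n : ℝ) + 1 := Real.mul_self_sqrt (by positivity)
    have hw : (n : ℝ) + 1 - 1 = n := by ring
    rw [hw] at hx
    have hf1 : Real.sqrt (n + 1).factorial = u * Real.sqrt n.factorial := by
      rw [Nat.factorial_succ, Nat.cast_mul, Real.sqrt_mul (by positivity)]
      push_cast
      rfl
    have hf2 : Real.sqrt (n + 2).factorial = s * (u * Real.sqrt n.factorial) := by
      rw [← hf1, Nat.factorial_succ, Nat.cast_mul, Real.sqrt_mul (by positivity)]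
      push_cast
      rfl
    have hc1 : Real.sqrt ((n + 1 : ℕ) : ℝ) = u := by push_cast; rfl
    have hc2 : Real.sqrt ((n + 2 : ℕ) : ℝ) = s := by
      rw [← one_add_one_eq_two, ← add_assoc]; push_cast; rfl
    rw [hc1, hf1] at ih1
    rw [hc2, hf2]
    set f := Real.sqrt n.factorial
    set w := Real.sqrt (n : ℝ)
    have hf0 : 0 ≤ f := Real.sqrt_nonneg _
    have hu0 : 0 ≤ u := Real.sqrt_nonneg _
    have e1 : Real.exp u = Real.exp (-(s - u)) * Real.exp s := by
      rw [← Real.exp_add]; congr 1; ring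
    have e2 : Real.exp w = Real.exp (-(s - w)) * Real.exp s := by
      rw [← Real.exp_add]; congr 1; ring
    calc (numInvolutions (n + 2) : ℝ)
        ≤ u * f * Real.exp u + u * u * (f * Real.exp w) := by
          rw [hu]
          exact hrec.trans (add_le_add ih1 (mul_le_mul_of_nonneg_left ih0 (by positivity)))
      _ = (u * f * Real.exp s) *
            (Real.exp (-(s - u)) + u * Real.exp (-(s - w))) := by
          rw [e1, e2]; ring
      _ ≤ (u * f * Real.exp s) * s := mul_le_mul_of_nonneg_left hx (by positivity)
      _ = s * (u * f) * Real.exp s := by ring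

end SymDim
end

/-! ### An elementary lower bound for the partition function. -/

noncomputable section

namespace SymDim

open Filter Topology

theorem card_partition_sub_le {n v k : ℕ} (hv : 0 < v) (h : k * v ≤ n) :
    Fintype.card (n - k * v).Partition ≤
      (Finset.univ.filter fun μ : n.Partition => k ≤ μ.parts.count v).card := by
  refine Finset.card_le_card_of_injOn (fun μ =>
    { parts := Multiset.replicate k v + μ.parts
      parts_pos := fun {i} hi => by
        rcases Multiset.mem_add.mp hi with hi | hi
        · rw [Multiset.eq_of_mem_replicate hi]
          exact hv
        · exact μ.parts_pos hi
      parts_sum := by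
        rw [Multiset.sum_add, Multiset.sum_replicate, μ.parts_sum, smul_eq_mul]
        omega }) ?_ ?_
  · intro μ _
    simp
  · intro μ _ ν _ hμν
    have := congrArg Nat.Partition.parts hμν
    exact Nat.Partition.ext (add_left_cancel this)

theorem sum_mul_count_le {n : ℕ} (μ : n.Partition) (V : ℕ) :
    ∑ v ∈ Finset.Icc 1 V, v * μ.parts.count v ≤ n := by
  have h : ∑ v ∈ μ.parts.toFinset, v * μ.parts.count v = n := by
    conv_rhs => rw [← μ.parts_sum, Finset.sum_multiset_count]
    simp [mul_comm]
  refine le_trans ?_ h.le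
  refine Finset.sum_le_sum_of_ne_zero fun v _ hv => ?_
  rw [Multiset.mem_toFinset, ← Multiset.count_ne_zero]
  exact fun h0 => hv (by rw [h0, mul_zero])

/-- Sum `n = ∑ v · count v` over all partitions, write each multiplicity as the number of `k` with
`1 ≤ k ≤ count v`, and truncate in `k` and `v`. -/
theorem sum_mul_card_partition_sub_le {n K V : ℕ} (hKV : K * V ≤ n) :
    ∑ k ∈ Finset.Icc 1 K, ∑ v ∈ Finset.Icc 1 V, v * Fintype.card (n - k * v).Partition ≤
      n * Fintype.card n.Partition := by
  have h1 : ∀ μ : n.Partition, ∑ v ∈ Finset.Icc 1 V, ∑ k ∈ Finset.Icc 1 K,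
      v * (if k ≤ μ.parts.count v then 1 else 0) ≤ n := fun μ => by
    refine le_trans (Finset.sum_le_sum fun v _ => ?_) (sum_mul_count_le μ V)
    rw [← Finset.mul_sum, Finset.sum_boole]
    refine Nat.mul_le_mul_left v ?_
    refine le_trans (Finset.card_le_card (t := Finset.Icc 1 (μ.parts.count v)) fun k hk => ?_)
      (by simp)
    simp only [Finset.mem_filter, Finset.mem_Icc] at hk ⊢
    omega
  have h2 := Finset.sum_le_sum fun μ (_ : μ ∈ Finset.univ) => h1 μ
  rw [Finset.sum_const, Finset.card_univ, smul_eq_mul, mul_comm (Fintype.card _)] at h2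
  refine le_trans ?_ h2
  rw [Finset.sum_comm (s := Finset.univ), Finset.sum_comm]
  refine Finset.sum_le_sum fun v hv => ?_
  rw [Finset.sum_comm]
  refine Finset.sum_le_sum fun k hk => ?_
  rw [← Finset.mul_sum, Finset.sum_boole]
  rw [Finset.mem_Icc] at hv hk
  exact Nat.mul_le_mul_left v (card_partition_sub_le hv.1
    ((Nat.mul_le_mul hk.2 hv.2).trans hKV))

theorem sum_Icc_mul_pow (q : ℝ) (V : ℕ) : (∑ v ∈ Finset.Icc 1 V, (v : ℝ) * q ^ v) * (1 - q) ^ 2 =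
    q * (1 - q ^ V * (1 + V * (1 - q))) := by
  induction V with
  | zero => simp
  | succ V ih =>
    rw [Finset.sum_Icc_succ_top (by omega), add_mul, ih]
    push_cast
    ring

/-- The closed form at `q = exp (-(c/x))`, with `1 - q ≤ c/x`. The main term is `x²/c²`; the last
factor tends to `1` as `V/x → ∞`. -/
theorem le_sum_mul_exp {c x : ℝ} (hc : 0 < c) (hx : 0 < x) (V : ℕ) :
    x ^ 2 * (1 / c ^ 2 * Real.exp (-(c / x)) *
      (1 - (1 + c * (V / x)) * Real.exp (-(c * (V / x))))) ≤
      ∑ v ∈ Finset.Icc 1 V, (v : ℝ) * Real.exp (-(c * v / x)) := by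
  set q := Real.exp (-(c / x)) with hq
  have hcx : 0 < c / x := div_pos hc hx
  have hpow : ∀ v : ℕ, Real.exp (-(c * v / x)) = q ^ v := fun v => by
    rw [hq, ← Real.exp_nat_mul]; congr 1; ring
  have hq1 : q < 1 := by
    rw [hq, ← Real.exp_zero]
    exact Real.exp_lt_exp.mpr (by linarith)
  have hqc : 1 - q ≤ c / x := by linarith [Real.add_one_le_exp (-(c / x))]
  have hq0 : 0 < q := Real.exp_pos _
  have h := sum_Icc_mul_pow q V
  simp_rw [hpow]
  have hV : Real.exp (-(c * (V / x))) = q ^ V := by rw [← hpow]; congr 1; ring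
  rw [hV]
  have hS : 0 ≤ ∑ v ∈ Finset.Icc 1 V, (v : ℝ) * q ^ v :=
    Finset.sum_nonneg fun v _ => by positivity
  set S := ∑ v ∈ Finset.Icc 1 V, (v : ℝ) * q ^ v
  have h1 : q * (1 - (1 + c * (V / x)) * q ^ V) ≤ S * (c / x) ^ 2 := by
    calc q * (1 - (1 + c * (V / x)) * q ^ V) ≤ q * (1 - q ^ V * (1 + V * (1 - q))) := by
          refine mul_le_mul_of_nonneg_left ?_ hq0.le
          have : q ^ V * (1 + V * (1 - q)) ≤ q ^ V * (1 + V * (c / x)) := by gcongr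
          have h2 : c * (V / x) = V * (c / x) := by ring
          rw [h2]
          linarith
      _ = S * (1 - q) ^ 2 := h.symm
      _ ≤ S * (c / x) ^ 2 := by
          refine mul_le_mul_of_nonneg_left ?_ hS
          exact pow_le_pow_left₀ (by linarith) hqc 2
  calc _ = (q * (1 - (1 + c * (V / x)) * q ^ V)) * (x / c) ^ 2 := by
        field_simp
    _ ≤ (S * (c / x) ^ 2) * (x / c) ^ 2 := by gcongr
    _ = S := by field_simp

/-- Rationalise the difference; using `H` in the denominator makes the slope uniform over `h ≤ H`.
-/
theorem sqrt_sub_sqrt_sub_le {x h H : ℝ} (hx : 0 < x) (hh : 0 ≤ h) (hH : h ≤ H) (hHx : H ≤ x) :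
    Real.sqrt x - Real.sqrt (x - h) ≤ h / (1 + Real.sqrt (1 - H / x)) / Real.sqrt x := by
  have hsx : 0 < Real.sqrt x := Real.sqrt_pos.mpr hx
  have h1 : Real.sqrt x * Real.sqrt (1 - H / x) ≤ Real.sqrt (x - h) := by
    rw [← Real.sqrt_mul hx.le]
    apply Real.sqrt_le_sqrt
    rw [mul_sub, mul_one, mul_div_cancel₀ _ hx.ne']
    linarith
  set r := Real.sqrt (1 - H / x)
  have hr : 0 ≤ r := Real.sqrt_nonneg _
  rw [div_div, le_div_iff₀ (by positivity)]
  have h2 := Real.sq_sqrt hx.le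
  have h3 := Real.sq_sqrt (by linarith : 0 ≤ x - h)
  have h4 : Real.sqrt (x - h) ≤ Real.sqrt x := Real.sqrt_le_sqrt (by linarith)
  nlinarith

/-- The truncation `⌊n ^ (3/4)⌋` of part sizes. -/
def cutoff (n : ℕ) : ℕ := ⌊(n : ℝ) ^ (3 / 4 : ℝ)⌋₊

/-- The exponent `3/4` lies strictly between `1/2` and `1`: the cutoff must outgrow `√n` to lose no
mass, yet be `o(n)` for the square root to be nearly linear. -/
theorem tendsto_cutoff_div_rpow :
    Tendsto (fun n : ℕ => (cutoff n : ℝ) / (n : ℝ) ^ (3 / 4 : ℝ)) atTop (𝓝 1) :=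
  (tendsto_nat_floor_div_atTop (R := ℝ)).comp
    ((tendsto_rpow_atTop (by norm_num)).comp tendsto_natCast_atTop_atTop)

theorem tendsto_cutoff_div_sqrt :
    Tendsto (fun n : ℕ => (cutoff n : ℝ) / Real.sqrt n) atTop atTop := by
  have h : Tendsto (fun n : ℕ => (n : ℝ) ^ (1 / 4 : ℝ)) atTop atTop :=
    (tendsto_rpow_atTop (by norm_num)).comp tendsto_natCast_atTop_atTop
  refine (tendsto_cutoff_div_rpow.pos_mul_atTop one_pos h).congr' ?_
  filter_upwards [eventually_gt_atTop 0] with n hn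
  have hn' : (0 : ℝ) < n := by exact_mod_cast hn
  rw [Real.sqrt_eq_rpow, div_mul_eq_mul_div, div_eq_div_iff (by positivity) (by positivity),
    mul_assoc, ← Real.rpow_add hn']
  norm_num

theorem tendsto_cutoff_div : Tendsto (fun n : ℕ => (cutoff n : ℝ) / n) atTop (𝓝 0) := by
  have h : Tendsto (fun n : ℕ => (n : ℝ) ^ (-(1 / 4) : ℝ)) atTop (𝓝 0) :=
    (tendsto_rpow_neg_atTop (by norm_num)).comp tendsto_natCast_atTop_atTop
  have h' := tendsto_cutoff_div_rpow.mul h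
  rw [mul_zero] at h'
  refine h'.congr' ?_
  filter_upwards [eventually_gt_atTop 0] with n hn
  have hn' : (0 : ℝ) < n := by exact_mod_cast hn
  rw [div_mul_eq_mul_div, div_eq_div_iff (by positivity) (by positivity), mul_assoc]
  congr 1
  nth_rw 2 [← Real.rpow_one (n : ℝ)]
  rw [← Real.rpow_add hn']
  norm_num

/-- Since `√n - √(n - kv)` is about `kv/(2√n)`, the inner sum is about `4n/(a²k²)`. The hypothesis
on `K` makes the total exceed `n` eventually, which closes the induction for `p(n)`. -/
theorem eventually_le_sum_mul_exp {a : ℝ} (ha : 0 < a) {K : ℕ}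
    (haK : a ^ 2 / 4 < ∑ k ∈ Finset.Icc 1 K, 1 / (k : ℝ) ^ 2) :
    ∀ᶠ n : ℕ in atTop, K * cutoff n ≤ n ∧
      (n : ℝ) ≤ ∑ k ∈ Finset.Icc 1 K, ∑ v ∈ Finset.Icc 1 (cutoff n),
        (v : ℝ) * Real.exp (-(a * (Real.sqrt n - Real.sqrt (n - (k * v : ℕ))))) := by
  -- The uniform slope of `a(√n - √(n - h))` in `h/√n`; it tends to `a/2`.
  set b : ℕ → ℝ := fun n => a / (1 + Real.sqrt (1 - K * cutoff n / n)) with hb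
  have hKn : Tendsto (fun n : ℕ => (K : ℝ) * cutoff n / n) atTop (𝓝 0) := by
    have := tendsto_cutoff_div.const_mul (K : ℝ)
    rw [mul_zero] at this
    exact this.congr fun n => by ring
  have hbt : Tendsto b atTop (𝓝 (a / 2)) := by
    have h1 : Tendsto (fun n : ℕ => Real.sqrt (1 - K * cutoff n / n)) atTop (𝓝 1) := by
      have := (hKn.const_sub 1).sqrt
      simpa using this
    have h2 := (tendsto_const_nhds (x := a)).div (h1.const_add 1) (by norm_num)
    rw [one_add_one_eq_two] at h2
    exact h2
  have hb0 : ∀ n, 0 < b n := fun n => div_pos ha (by positivity)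
  set E : ℕ → ℕ → ℝ := fun k n => 1 / (b n * k) ^ 2 * Real.exp (-(b n * k / Real.sqrt n)) *
      (1 - (1 + b n * k * (cutoff n / Real.sqrt n)) *
        Real.exp (-(b n * k * (cutoff n / Real.sqrt n)))) with hE
  have hsq : Tendsto (fun n : ℕ => Real.sqrt n) atTop atTop :=
    Real.tendsto_sqrt_atTop.comp tendsto_natCast_atTop_atTop
  have hEt : ∀ k ∈ Finset.Icc 1 K, Tendsto (E k) atTop (𝓝 (4 / a ^ 2 * (1 / (k : ℝ) ^ 2))) := by
    intro k hk
    have hk0 : (0 : ℝ) < k := by exact_mod_cast (Finset.mem_Icc.mp hk).1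
    have hbk : Tendsto (fun n => b n * k) atTop (𝓝 (a / 2 * k)) := hbt.mul_const _
    have h1 : Tendsto (fun n => 1 / (b n * k) ^ 2) atTop (𝓝 (1 / (a / 2 * k) ^ 2)) :=
      tendsto_const_nhds.div (hbk.pow 2) (by positivity)
    have h2 : Tendsto (fun n : ℕ => Real.exp (-(b n * k / Real.sqrt n))) atTop (𝓝 1) := by
      have := (hbk.div_atTop hsq).neg
      rw [neg_zero] at this
      simpa using this.rexp
    have hy : Tendsto (fun n : ℕ => b n * k * (cutoff n / Real.sqrt n)) atTop atTop :=
      hbk.pos_mul_atTop (by positivity) tendsto_cutoff_div_sqrt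
    have h3 : Tendsto (fun y : ℝ => 1 - (1 + y) * Real.exp (-y)) atTop (𝓝 1) := by
      have e0 := Real.tendsto_pow_mul_exp_neg_atTop_nhds_zero 0
      have e1 := Real.tendsto_pow_mul_exp_neg_atTop_nhds_zero 1
      have := (e0.add e1).const_sub 1
      simp only [add_zero, sub_zero] at this
      exact this.congr fun y => by ring
    have h4 := (h1.mul h2).mul (h3.comp hy)
    have h5 : (1 : ℝ) / (a / 2 * k) ^ 2 * 1 * 1 = 4 / a ^ 2 * (1 / (k : ℝ) ^ 2) := by
      field_simp
      norm_num
    rw [h5] at h4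
    exact h4
  have hsum := tendsto_finsetSum _ hEt
  rw [← Finset.mul_sum] at hsum
  have hgt : 1 < 4 / a ^ 2 * ∑ k ∈ Finset.Icc 1 K, 1 / (k : ℝ) ^ 2 := by
    rw [div_mul_eq_mul_div, lt_div_iff₀ (by positivity)]
    linarith
  filter_upwards [hsum.eventually (lt_mem_nhds hgt), hKn.eventually (gt_mem_nhds one_pos),
    eventually_gt_atTop 0] with n h1 h2 hn
  have hn' : (0 : ℝ) < n := by exact_mod_cast hn
  have hKle : (K : ℝ) * cutoff n ≤ n := by
    rw [div_lt_one hn'] at h2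
    exact h2.le
  refine ⟨by exact_mod_cast hKle, ?_⟩
  have hsx : 0 < Real.sqrt n := Real.sqrt_pos.mpr hn'
  calc (n : ℝ) ≤ n * ∑ k ∈ Finset.Icc 1 K, E k n := le_mul_of_one_le_right hn'.le h1.le
    _ = ∑ k ∈ Finset.Icc 1 K, Real.sqrt n ^ 2 * E k n := by
        rw [Real.sq_sqrt hn'.le, Finset.mul_sum]
    _ ≤ _ := Finset.sum_le_sum fun k hk => ?_
  have hk0 : (0 : ℝ) < k := by exact_mod_cast (Finset.mem_Icc.mp hk).1
  refine (le_sum_mul_exp (mul_pos (hb0 n) hk0) hsx (cutoff n)).trans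
    (Finset.sum_le_sum fun v hv => ?_)
  refine mul_le_mul_of_nonneg_left (Real.exp_le_exp.mpr (neg_le_neg ?_)) (Nat.cast_nonneg v)
  have hkv : ((k * v : ℕ) : ℝ) ≤ K * cutoff n := by
    exact_mod_cast Nat.mul_le_mul (Finset.mem_Icc.mp hk).2 (Finset.mem_Icc.mp hv).2
  refine (mul_le_mul_of_nonneg_left (sqrt_sub_sqrt_sub_le hn' (Nat.cast_nonneg _) hkv hKle)
    ha.le).trans (le_of_eq ?_)
  simp only [hb]
  push_cast
  ring

/-- Exponential lower bounds for the partition function. -/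
theorem exists_mul_exp_sqrt_le_card_partition {a : ℝ} (ha : 0 < a) {K : ℕ}
    (haK : a ^ 2 / 4 < ∑ k ∈ Finset.Icc 1 K, 1 / (k : ℝ) ^ 2) :
    ∃ ε : ℝ, 0 < ε ∧ ∀ n : ℕ, ε * Real.exp (a * Real.sqrt n) ≤ Fintype.card n.Partition := by
  obtain ⟨N, hN⟩ := eventually_atTop.mp (eventually_le_sum_mul_exp ha haK)
  -- This constant makes the bound at most `1` for all `n ≤ N`, where `p(n) ≥ 1` suffices.
  refine ⟨Real.exp (-(a * Real.sqrt N)), Real.exp_pos _, fun n => ?_⟩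
  set ε := Real.exp (-(a * Real.sqrt N)) with hε
  induction n using Nat.strong_induction_on with
  | _ n ih =>
    by_cases hn : n ≤ N ∨ n = 0
    · have h1 : (1 : ℝ) ≤ Fintype.card n.Partition := by
        exact_mod_cast Fintype.card_pos (α := n.Partition)
      refine le_trans ?_ h1
      rw [hε, ← Real.exp_add, Real.exp_le_one_iff]
      have h2 : Real.sqrt n ≤ Real.sqrt N := by
        apply Real.sqrt_le_sqrt
        rcases hn with hn | hn
        · exact_mod_cast hn
        · rw [hn]; simp
      nlinarith
    · push Not at hn
      obtain ⟨h1, h2⟩ := hN n hn.1.le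
      have hn' : (0 : ℝ) < n := by exact_mod_cast Nat.pos_of_ne_zero hn.2
      have h3 : ((∑ k ∈ Finset.Icc 1 K, ∑ v ∈ Finset.Icc 1 (cutoff n),
          v * Fintype.card (n - k * v).Partition : ℕ) : ℝ) ≤
          (n : ℝ) * Fintype.card n.Partition := by exact_mod_cast sum_mul_card_partition_sub_le h1
      refine le_of_mul_le_mul_left ?_ hn'
      refine le_trans ?_ h3
      push_cast
      calc (n : ℝ) * (ε * Real.exp (a * Real.sqrt n)) ≤
          (∑ k ∈ Finset.Icc 1 K, ∑ v ∈ Finset.Icc 1 (cutoff n), (v : ℝ) *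
            Real.exp (-(a * (Real.sqrt n - Real.sqrt (n - (k * v : ℕ)))))) *
            (ε * Real.exp (a * Real.sqrt n)) :=
              mul_le_mul_of_nonneg_right h2 (by positivity)
        _ ≤ _ := ?_
      rw [Finset.sum_mul]
      refine Finset.sum_le_sum fun k hk => ?_
      rw [Finset.sum_mul]
      refine Finset.sum_le_sum fun v hv => ?_
      rw [Finset.mem_Icc] at hk hv
      have hle : k * v ≤ n := (Nat.mul_le_mul hk.2 hv.2).trans h1
      have hlt : n - k * v < n :=
        Nat.sub_lt (Nat.pos_of_ne_zero hn.2) (Nat.mul_pos hk.1 hv.1)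
      refine le_trans (le_of_eq ?_)
        (mul_le_mul_of_nonneg_left (ih _ hlt) (Nat.cast_nonneg v))
      rw [Nat.cast_sub hle, mul_assoc]
      congr 1
      rw [mul_left_comm, ← Real.exp_add]
      congr 2
      ring

end SymDim

end

/-! ### Combining the estimates. -/

noncomputable section

namespace SymDim

open Filter

variable {n : ℕ}

theorem mul_card_largeDim_le (A : ℝ) :
    (maxDim n : ℝ) * A * (largeDim n A).ncard ≤ numInvolutions n := by
  classical
  rw [Set.ncard_eq_toFinset_card' (largeDim n A), numInvolutions, ← sum_dim, Nat.cast_sum,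
    mul_comm, ← nsmul_eq_mul, ← Finset.sum_const]
  refine (Finset.sum_le_sum fun μ hμ => (Set.mem_toFinset.mp hμ).1).trans ?_
  exact Finset.sum_le_sum_of_subset_of_nonneg (Finset.subset_univ _)
    fun _ _ _ => Nat.cast_nonneg _

/-- Multiplying by `n! ≤ m_n I` cancels the unknown `m_n` and leaves `I²`. -/
theorem mul_card_partition_le {A C : ℝ} (hA : 0 < A)
    (hC : C * (Fintype.card n.Partition : ℝ) = ((largeDim n A).ncard : ℝ)) :
    A * C * Fintype.card n.Partition ≤ Real.exp (2 * Real.sqrt n) := by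
  have hf : (0 : ℝ) < n.factorial := by exact_mod_cast n.factorial_pos
  have h1 := mul_card_largeDim_le (n := n) A
  have h2 : (n.factorial : ℝ) ≤ maxDim n * numInvolutions n := by
    exact_mod_cast factorial_le_maxDim_mul
  have h3 := numInvolutions_le (n := n)
  have hAC : 0 ≤ A * C * Fintype.card n.Partition := by
    rw [mul_assoc, hC]
    positivity
  have h4 : (numInvolutions n : ℝ) ^ 2 ≤ n.factorial * Real.exp (2 * Real.sqrt n) := by
    calc (numInvolutions n : ℝ) ^ 2 ≤ (Real.sqrt n.factorial * Real.exp (Real.sqrt n)) ^ 2 := by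
          gcongr
      _ = n.factorial * Real.exp (2 * Real.sqrt n) := by
          rw [mul_pow, Real.sq_sqrt hf.le, ← Real.exp_nat_mul]
          push_cast
          rfl
  refine le_of_mul_le_mul_left ?_ hf
  calc (n.factorial : ℝ) * (A * C * Fintype.card n.Partition)
      ≤ maxDim n * numInvolutions n * (A * C * Fintype.card n.Partition) := by gcongr
    _ = (maxDim n * A * (largeDim n A).ncard) * numInvolutions n := by rw [← hC]; ring
    _ ≤ numInvolutions n * numInvolutions n := by gcongr
    _ ≤ _ := by rw [← sq]; exact h4

theorem pi_mul_sqrt_two_div_sqrt_three_lt : Real.pi * Real.sqrt 2 / Real.sqrt 3 < 2.57 := by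
  have h2 : Real.sqrt 2 < 1.4143 := by
    rw [Real.sqrt_lt' (by norm_num)]; norm_num
  have h3 : 1.732 < Real.sqrt 3 := by
    rw [Real.lt_sqrt (by norm_num)]; norm_num
  have hpi := Real.pi_lt_d4
  rw [div_lt_iff₀ (by positivity)]
  calc Real.pi * Real.sqrt 2 < 3.1416 * 1.4143 := by gcongr
    _ < 2.57 * 1.732 := by norm_num
    _ ≤ 2.57 * Real.sqrt 3 := by gcongr

theorem eventually_exp_le_card_partition :
    ∀ᶠ n : ℕ in atTop,
      Real.exp ((1 + Real.pi * Real.sqrt 2 / Real.sqrt 3 / 2) * Real.sqrt n) ≤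
        Fintype.card n.Partition := by
  -- Three terms suffice: `2.29²/4 < 1.312 < 1 + 1/4 + 1/9`, while `1 + c/2 < 2.285 < 2.29`. The
  -- surplus `d` in the exponent absorbs `ε`.
  obtain ⟨ε, hε, h⟩ := exists_mul_exp_sqrt_le_card_partition (a := 2.29) (K := 3)
    (by norm_num) (by simp [Finset.sum_Icc_succ_top]; norm_num)
  set d : ℝ := 2.29 - (1 + Real.pi * Real.sqrt 2 / Real.sqrt 3 / 2) with hd
  have hd0 : 0 < d := by linarith [pi_mul_sqrt_two_div_sqrt_three_lt]
  have ht : Tendsto (fun n : ℕ => Real.exp (d * Real.sqrt n)) atTop atTop :=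
    Real.tendsto_exp_atTop.comp ((Real.tendsto_sqrt_atTop.comp
      tendsto_natCast_atTop_atTop).const_mul_atTop hd0)
  filter_upwards [ht.eventually_ge_atTop ε⁻¹] with n hn
  refine le_trans ?_ (h n)
  have h1 : (2.29 : ℝ) * Real.sqrt n = d * Real.sqrt n +
      (1 + Real.pi * Real.sqrt 2 / Real.sqrt 3 / 2) * Real.sqrt n := by rw [hd]; ring
  rw [h1, Real.exp_add, ← mul_assoc]
  refine le_mul_of_one_le_left (Real.exp_pos _).le ?_
  rwa [inv_le_iff_one_le_mul₀' hε] at hn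

end SymDim

end

theorem mainTheorem6 :
    ∃ N : ℕ, ∀ n : ℕ, N ≤ n → ∀ A C : ℝ, 0 < A → A < 1 →
      C * (Fintype.card n.Partition : ℝ) = ((SymDim.largeDim n A).ncard : ℝ) →
      (A * C) ^ 2 ≤
        Real.exp (-(Real.pi * Real.sqrt 2 / Real.sqrt 3 - 2) * Real.sqrt (n : ℝ)) := by
  obtain ⟨N, hN⟩ := Filter.eventually_atTop.mp SymDim.eventually_exp_le_card_partition
  refine ⟨N, fun n hn A C hA _ hC => ?_⟩
  have hp := hN n hn
  set c := Real.pi * Real.sqrt 2 / Real.sqrt 3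
  have hp0 : (0 : ℝ) < Fintype.card n.Partition := (Real.exp_pos _).trans_le hp
  have hC0 : 0 ≤ C := by
    by_contra hneg
    have h1 := mul_neg_of_neg_of_pos (not_le.mp hneg) hp0
    rw [hC] at h1
    exact absurd h1 (not_lt.mpr (Nat.cast_nonneg _))
  have hAC : 0 ≤ A * C := mul_nonneg hA.le hC0
  have h1 : A * C * Real.exp ((1 + c / 2) * Real.sqrt n) ≤ Real.exp (2 * Real.sqrt n) :=
    (mul_le_mul_of_nonneg_left hp hAC).trans (SymDim.mul_card_partition_le hA hC)
  have h2 : A * C ≤ Real.exp ((1 - c / 2) * Real.sqrt n) := by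
    refine le_of_mul_le_mul_right (h1.trans (le_of_eq ?_))
      (Real.exp_pos ((1 + c / 2) * Real.sqrt n))
    rw [← Real.exp_add]
    congr 1
    ring
  calc (A * C) ^ 2 ≤ Real.exp ((1 - c / 2) * Real.sqrt n) ^ 2 := by gcongr
    _ = Real.exp (-(c - 2) * Real.sqrt n) := by
        rw [← Real.exp_nat_mul]
        congr 1
        push_cast
        ring
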